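/- Let $P$ be the transition matrix of an irreducible Markov chain on a finite state space $V$ with $|V|\ge 2$, and let $\pi$ be its stationary distribution (where $\pi$ has no argument and stands as a number, it is the circle constant). For $A,B\subseteq V$ put $\pi(A)=\sum_{x\in A}\pi(x)$, $Q(A,B)=\sum_{x\in A,\,y\in B}\pi(x)P(x,y)$, $\hat Q(A,x)=\min\{Q(A,\{x\}),\pi(x)/2\}$, and for $A\ne\emptyset$ $$\hat\Psi(A)=\min_{\substack{B\subseteq V,\ v\in V\\ \pi(B)\le\pi(A^c)<\pi(B\cup\{v\})}}\ \sum_{x\in B}\hat Q(A,x)+\frac{\pi(A^c)-\pi(B)}{\pi(v)}\,\hat Q(A,v).$$ Let $$\hat\Psi_{\min}=\min_{A\neq\emptyset,\ \pi(A)\le 1/2}\hat\Psi(A),\qquad \Delta_{\min}=\min_{\pi(A)\ne\pi(B)}|\pi(A)-\pi(B)|,\qquad Q_{\min}=\min_{\emptyset\ne A\subsetneq V}Q(A,A^c),$$ $$\pi_*=\min_{x\in V}\pi(x),\qquad \hat A_{\min}=\min\{\hat\Psi_{\min},\Delta_{\min}/2\},\qquad \hat A_{\max}=\max\{\hat\Psi_{\min},\Delta_{\min}/2\},$$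 $$g=2\,\frac{\hat A_{\min}}{\Delta_{\min}}\bigl(1-\cos(2\pi\hat A_{\max})\bigr).$$ Let $\tau(\epsilon)$ be the first time $t\ge 0$ with $\max_{x}\frac12\sum_y|P^t(x,y)-\pi(y)|\le\epsilon$ (and $\infty$ if there is none), and let $\lambda$ be the spectral gap, that is, the smallest value of $1-\mu$ over the eigenvalues $\mu\neq1$ of $\frac12(P+P^*)$, where $P^*(x,y)=\pi(y)P(y,x)/\pi(x)$. **(1) Bounds.** Every complex eigenvalue $\lambda_i\ne1$ of $P$ satisfies $1-|\lambda_i|\ge g$. The spectral gap satisfies $$\lambda\ \ge\ \frac{2Q_{\min}}{\pi_*}\bigl(1-\cos(\pi\,\pi_*)\bigr).$$ If $\hat\Psi_{\min}>0$, then for every $\epsilon>0$ $$\tau(\epsilon)\ \le\ \left\lceil \frac{1}{-\log(1-g)}\,\log\frac{1-\pi_*}{\epsilon}\right\rceil$$ when $g<1$ (a negative right-hand side being read as $0$), and $\tau(\epsilon)\le1$ in the remaining case $g\geq 1$. **(2) Leading order.** For every $\delta>0$ there is $\eta>0$ such that for every chain as above: if $\hat A_{\max}<\eta$, then $g$ agrees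 with $2\pi^2\hat\Psi_{\min}\hat A_{\max}$ up to a relative error of at most $\delta$, and, if moreover $\hat\Psi_{\min}>0$, then for every $\epsilon>0$ so does $\frac{1}{-\log(1-g)}\log\frac{1-\pi_*}{\epsilon}$ with $\frac{1}{2\pi^2\hat\Psi_{\min}\hat A_{\max}}\log\frac{1-\pi_*}{\epsilon}$; if $\pi_*<\eta$, then $\frac{2Q_{\min}}{\pi_*}(1-\cos(\pi\,\pi_*))$ agrees with $\pi^2\,\pi_*Q_{\min}$ up to a relative error of at most $\delta$. **(3) Sharpness.** Let $n\ge3$ be odd and $\alpha\in[1/2,1)$, and consider the walk on the cycle $\mathbb Z/n$ with $P(x,x+1)=\alpha$ and $P(x,x-1)=1-\alpha$. Then $\hat\Psi_{\min}=(1-\alpha)\pi_*$, there is an eigenvalue $\lambda_i\ne1$ of $P$ with $1-|\lambda_i|\le 2g$, the spectral gap satisfies $\lambda\le 2\cdot\frac{2Q_{\min}}{\pi_*}(1-\cos(\pi\,\pi_*))$, and for every $\epsilon>0$ $$\tau(\epsilon)\ \ge\ \frac12\cdot\frac{1}{-\log(1-g)}\,\log\frac{1}{2\epsilon}.$$ 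-/

import Mathlib

open scoped ENNReal

universe u

/-- A finite irreducible Markov chain on the state space `V`: a stochastic matrix `P` such that every
state can be reached from every state, together with its stationary distribution `stat`
(which irreducibility makes unique). -/
structure FiniteMarkovChain (V : Type u) [Fintype V] [DecidableEq V] where
  P : Matrix V V ℝ
  P_nonneg : ∀ x y, 0 ≤ P x y
  P_row_sum : ∀ x, ∑ y, P x y = 1
  irreducible : ∀ x y, ∃ t : ℕ, 0 < (P ^ t) x y
  stat : V → ℝ
  stat_nonneg : ∀ x, 0 ≤ stat x
  stat_sum : ∑ x, stat x = 1
  stationary : ∀ y, ∑ x, stat x * P x y = stat y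

namespace FiniteMarkovChain

noncomputable section

variable {V : Type u} [Fintype V] [DecidableEq V] (M : FiniteMarkovChain V)

/-- The stationary measure of a set. -/
def meas (A : Finset V) : ℝ := ∑ x ∈ A, M.stat x

/-- The ergodic flow from `A` to `B`. -/
def flow (A B : Finset V) : ℝ := ∑ x ∈ A, ∑ y ∈ B, M.stat x * M.P x y

/-- The truncated flow from the set `A` to the vertex `x`. -/
def hatFlow (A : Finset V) (x : V) : ℝ := min (M.flow A {x}) (M.stat x / 2)

/-- The modified edge expansion of the set `A`. The infimum is a minimum over a finite set, which is
nonempty unless `A = ∅`. -/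
def hatPsi (A : Finset V) : ℝ :=
  sInf {r : ℝ | ∃ (B : Finset V) (v : V),
    M.meas B ≤ M.meas Aᶜ ∧ M.meas Aᶜ < M.meas (insert v B) ∧
    r = ∑ x ∈ B, M.hatFlow A x + (M.meas Aᶜ - M.meas B) / M.stat v * M.hatFlow A v}

/-- The minimum of `hatPsi A` over the nonempty sets `A` of measure at most `1/2`. -/
def hatPsiMin : ℝ :=
  sInf {r : ℝ | ∃ A : Finset V, A.Nonempty ∧ M.meas A ≤ 1 / 2 ∧ r = M.hatPsi A}

/-- The smallest difference between two distinct values of the stationary measure. -/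
def deltaMin : ℝ :=
  sInf {r : ℝ | ∃ A B : Finset V, M.meas A ≠ M.meas B ∧ r = |M.meas A - M.meas B|}

/-- The smallest ergodic flow out of a nonempty proper subset. -/
def flowMin : ℝ :=
  sInf {r : ℝ | ∃ A : Finset V, A.Nonempty ∧ A ≠ Finset.univ ∧ r = M.flow A Aᶜ}

/-- The smallest stationary probability of a state. -/
def statMin : ℝ := ⨅ x, M.stat x

def hatAMin : ℝ := min M.hatPsiMin (M.deltaMin / 2)

def hatAMax : ℝ := max M.hatPsiMin (M.deltaMin / 2)

/-- The lower bound for the eigenvalue gap. -/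
def gapBound : ℝ := 2 * (M.hatAMin / M.deltaMin) * (1 - Real.cos (2 * Real.pi * M.hatAMax))

/-- The distance in total variation of two distributions on `V`. -/
def tvDist (σ τ : V → ℝ) : ℝ := 1 / 2 * ∑ x, |σ x - τ x|

/-- The mixing time: the first `t` at which, from every starting state, the distribution after `t`
steps is within `ε` of the stationary one in total variation (`⊤` if there is no such `t`). -/
def mixingTime (ε : ℝ) : ℕ∞ :=
  ⨅ t ∈ {t : ℕ | ∀ x, tvDist ((M.P ^ t) x) M.stat ≤ ε}, (t : ℕ∞)

/-- `z` is a complex eigenvalue of the transition matrix. -/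
def IsEigenvalue (z : ℂ) : Prop :=
  Module.End.HasEigenvalue (Matrix.toLin' (M.P.map Complex.ofReal)) z

/-- The transition matrix of the time reversal. -/
def reversal : Matrix V V ℝ := Matrix.of fun x y => M.stat y * M.P y x / M.stat x

/-- The spectral gap: the smallest value of `1 - μ` over the eigenvalues `μ ≠ 1` of the additive
symmetrization of the chain. The latter is self-adjoint for the stationary inner product, so its
eigenvalues are real, and irreducible, so its eigenvalue `1` is simple. -/
def spectralGap : ℝ :=
  sInf {r : ℝ | ∃ μ : ℝ, μ ≠ 1 ∧
    Module.End.HasEigenvalue (Matrix.toLin' ((1 / 2 : ℝ) • (M.P + M.reversal))) μ ∧ r = 1 - μ}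

/-- The lower bound for the spectral gap. -/
def spectralGapBound : ℝ :=
  2 * M.flowMin / M.statMin * (1 - Real.cos (Real.pi * M.statMin))

end

/-- The transition matrix of the walk on the cycle `ZMod n` that moves one step clockwise with
probability `α` and one step counterclockwise with probability `1 - α`. -/
def cycleMatrix (n : ℕ) (α : ℝ) : Matrix (ZMod n) (ZMod n) ℝ :=
  Matrix.of fun x y => (if y = x + 1 then α else 0) + (if y = x - 1 then 1 - α else 0)

theorem cycleMatrix_nonneg (n : ℕ) (α : ℝ) (h0 : 0 < α) (h1 : α ≤ 1) (x y : ZMod n) :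
    0 ≤ cycleMatrix n α x y := by
  have h2 : 0 ≤ 1 - α := by linarith
  simp only [cycleMatrix, Matrix.of_apply]
  split_ifs <;> linarith

theorem cycleMatrix_pow_pos (n : ℕ) [NeZero n] (α : ℝ) (h0 : 0 < α) (h1 : α ≤ 1) (t : ℕ) :
    (∀ x y, 0 ≤ (cycleMatrix n α ^ t) x y) ∧ ∀ x : ZMod n, 0 < (cycleMatrix n α ^ t) x (x + t) := by
  induction t with
  | zero =>
    refine ⟨fun x y => ?_, fun x => by simp⟩
    simp only [pow_zero, Matrix.one_apply]
    split_ifs <;> norm_num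
  | succ t ih =>
    refine ⟨fun x y => ?_, fun x => ?_⟩
    · rw [pow_succ, Matrix.mul_apply]
      exact Finset.sum_nonneg fun z _ => mul_nonneg (ih.1 x z) (cycleMatrix_nonneg n α h0 h1 z y)
    · rw [pow_succ, Matrix.mul_apply]
      refine Finset.sum_pos' (fun z _ => mul_nonneg (ih.1 x z) (cycleMatrix_nonneg n α h0 h1 z _))
        ⟨x + t, Finset.mem_univ _, mul_pos (ih.2 x) ?_⟩
      have h2 : 0 ≤ 1 - α := by linarith
      have h3 : x + ((t + 1 : ℕ) : ZMod n) = x + t + 1 := by push_cast; ring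
      rw [h3]
      simp only [cycleMatrix, Matrix.of_apply, if_true]
      split_ifs <;> linarith

/-- The walk with drift on the cycle `ZMod n`. Its stationary distribution is uniform. -/
noncomputable def cycleWalk (n : ℕ) [NeZero n] (α : ℝ) (h0 : 0 < α) (h1 : α ≤ 1) :
    FiniteMarkovChain (ZMod n) where
  P := cycleMatrix n α
  P_nonneg := cycleMatrix_nonneg n α h0 h1
  P_row_sum x := by simp [cycleMatrix, Finset.sum_add_distrib]
  irreducible x y := by
    refine ⟨(y - x).val, ?_⟩
    have h := (cycleMatrix_pow_pos n α h0 h1 (y - x).val).2 x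
    rwa [ZMod.natCast_zmod_val, add_sub_cancel] at h
  stat _ := 1 / n
  stat_nonneg _ := by positivity
  stat_sum := by
    have : (n : ℝ) ≠ 0 := NeZero.ne _
    simp [ZMod.card, this]
  stationary y := by
    have e1 : ∀ x : ZMod n, (y = x + 1) = (x = y - 1) := fun x => by
      rw [eq_iff_iff]; constructor <;> rintro rfl <;> ring
    have e2 : ∀ x : ZMod n, (y = x - 1) = (x = y + 1) := fun x => by
      rw [eq_iff_iff]; constructor <;> rintro rfl <;> ring
    rw [← Finset.mul_sum]
    simp [cycleMatrix, Finset.sum_add_distrib, e1, e2]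

end FiniteMarkovChain

/-! The proof runs the evolving sets of the chain. Write p for the stationary measure. From a set A,
draw a level u uniformly in [0,1] and pass to the set A_u of all y with Q(A,y) ≥ u p(y). Its measure
m(u) is antitone with mean p(A), so by concavity the mean of sin(π m(u)) is at most sin(π p(A)).
Everything rests on a quantitative form of this, `SineContraction`: a gain of a factor 1 - κ for
sets of measure at most 1/2, which complements carry over to larger sets.

Two lemmas supply κ. `integral_sin_le_of_jump` uses that m(u) either equals p(A) or differs from it
by at least D. `integral_sin_le_of_half` uses only that the growth at levels u ≤ 1/2 is bounded
below. By `greedy_sum_le_integral` this growth is at least Ψ̂(A), and the comparison of Ψ̂_min with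
Δ_min/2 decides which lemma yields g. For the spectral gap the chain is replaced by its lazy
symmetrization, where each A_u contains A or is contained in it, so that D can be taken as the
smallest stationary probability.

Iteration writes p(x)P^t(x,y) as a nonnegative combination of restrictions of p to sets B, with the
weighted sum of sin(π p(B)) at most (1-κ)^t sin(π p(x)). The distance to stationarity is controlled
by the weighted sum of p(B)(1-p(B)), and Euler's product bounds z(1-z) by sin(πz) with the best
constant. The result is the geometric bound `IsStationaryPair.sum_abs_pow_sub_le`. Tested against an
eigenvector of mean zero as t grows, it bounds all eigenvalues other than one.

Sharpness comes from characters of the cycle: the lowest frequency for the spectral gap, and the one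
nearest to n/2 for the modulus of an eigenvalue and for the mixing time. -/

/-! ### Concavity inequalities for the sine. -/

open Real in
theorem sin_le_tangent {r s : ℝ} (hr0 : 0 ≤ r) (hr : r ≤ π) (hs0 : 0 ≤ s) (hs : s ≤ π) :
    sin s ≤ sin r + cos r * (s - r) := by
  rcases lt_trichotomy r s with h | h | h
  · obtain ⟨c, hc, hc'⟩ := exists_hasDerivAt_eq_slope sin cos h continuous_sin.continuousOn
      (fun x _ => hasDerivAt_sin x)
    have h1 : cos c ≤ cos r := cos_le_cos_of_nonneg_of_le_pi hr0 (hc.2.le.trans hs) hc.1.le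
    rw [eq_div_iff (by linarith)] at hc'
    nlinarith
  · subst h; simp
  · obtain ⟨c, hc, hc'⟩ := exists_hasDerivAt_eq_slope sin cos h continuous_sin.continuousOn
      (fun x _ => hasDerivAt_sin x)
    have h1 : cos r ≤ cos c := cos_le_cos_of_nonneg_of_le_pi (hs0.trans hc.1.le) hr hc.2.le
    rw [eq_div_iff (by linarith)] at hc'
    nlinarith

-- The point b + D divides the segment from b to b + T in the ratio 1 : q - 1, so concavity puts the
-- sine at b + T below the chord over [b, b + D] extended. The sign of D is free, which covers jumps
-- in both directions.
open Real in
theorem sin_chord {b D T : ℝ} (h0 : 0 ≤ b) (h1 : b ≤ π) (h2 : 0 ≤ b + T) (h3 : b + T ≤ π)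
    {q : ℝ} (hq : 1 ≤ q) (hT : T = q * D) :
    sin (b + T) ≤ sin b + q * (sin (b + D) - sin b) := by
  have hq0 : 0 < q := by linarith
  have h := strictConcaveOn_sin_Icc.concaveOn.2 ⟨h0, h1⟩ ⟨h2, h3⟩
    (show 0 ≤ 1 - 1 / q by rw [sub_nonneg, div_le_one hq0]; exact hq)
    (show 0 ≤ 1 / q by positivity) (by ring)
  have e : (1 - 1 / q) • b + (1 / q) • (b + T) = b + D := by
    simp only [smul_eq_mul]; rw [hT]; field_simp; ring
  rw [e] at h
  simp only [smul_eq_mul] at h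
  have h' := mul_le_mul_of_nonneg_left h hq0.le
  have e2 : q * ((1 - 1 / q) * sin b + 1 / q * sin (b + T)) = q * sin b - sin b + sin (b + T) := by
    field_simp
  rw [e2] at h'
  linarith

open Real in
/-- Comparison of the values at `b` of the tangents to the sine at `b - y` and at `b + x`. -/
theorem sin_tangent_value_le {b x y : ℝ} (hb0 : 0 ≤ b) (hb : b ≤ π / 2) (hy : 0 ≤ y) (hyx : y ≤ x)
    (hx : b + x ≤ π) :
    sin (b - y) + y * cos (b - y) ≤ sin (b + x) - x * cos (b + x) := by
  have h1 := sin_le_tangent (r := b + x) (s := b + y) (by linarith) hx (by linarith) (by linarith)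
  have h2 : cos (b + x) ≤ cos (b + y) :=
    cos_le_cos_of_nonneg_of_le_pi (by linarith) hx (by linarith)
  have h3 := sin_le_tangent (r := y) (s := 0) hy (by linarith) le_rfl pi_pos.le
  have h4 : 0 ≤ cos b := cos_nonneg_of_neg_pi_div_two_le_of_le (by linarith) hb
  -- In the symmetric case x = y the difference is 2 cos b (sin y - y cos y), which is nonnegative;
  -- `h1` and `h2` then move the right tangent point from b + y to b + x.
  have h5 : sin (b - y) + y * cos (b - y) ≤ sin (b + y) - y * cos (b + y) := by
    rw [sin_sub, cos_sub, sin_add, cos_add]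
    rw [sin_zero] at h3
    nlinarith
  nlinarith

-- As a function of p the left side is nondecreasing up to 1/2: its derivative is the difference of
-- two tangent values compared in `sin_tangent_value_le`. At p = 1/2 it equals the right side.
open Real in
theorem two_point_sin_le {b K p : ℝ} (hb0 : 0 ≤ b) (hb : b ≤ π / 2) (hK : 0 ≤ K) (hp0 : 0 < p)
    (hp : p ≤ 1 / 2) (hx : b + K / p ≤ π) :
    p * sin (b + K / p) + (1 - p) * sin (b - K / (1 - p)) ≤ sin b * cos (2 * K) := by
  have hder : ∀ q ∈ Set.Icc p (1 / 2 : ℝ), HasDerivAt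
      (fun q => q * sin (b + K / q) + (1 - q) * sin (b - K / (1 - q)))
      (sin (b + K / q) - K / q * cos (b + K / q)
        - (sin (b - K / (1 - q)) + K / (1 - q) * cos (b - K / (1 - q)))) q := by
    intro q hq
    have hq0 : q ≠ 0 := by linarith [hq.1]
    have hq1 : 1 - q ≠ 0 := by linarith [hq.2]
    have d1 : HasDerivAt (fun q : ℝ => b + K / q) (-K / q ^ 2) q := by
      have := ((hasDerivAt_inv hq0).const_mul K).const_add b
      exact this.congr_deriv (by field_simp)
    have d2 : HasDerivAt (fun q : ℝ => 1 - q) (-1) q := by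
      simpa using (hasDerivAt_id q).const_sub 1
    have d3 : HasDerivAt (fun q : ℝ => b - K / (1 - q)) (-(K / (1 - q) ^ 2)) q := by
      have := ((d2.inv hq1).const_mul K).const_sub b
      exact this.congr_deriv (by field_simp)
    refine (((hasDerivAt_id q).mul d1.sin).add (d2.mul d3.sin)).congr_deriv ?_
    simp only [id]
    field_simp
    ring
  have hmono : MonotoneOn (fun q => q * sin (b + K / q) + (1 - q) * sin (b - K / (1 - q)))
      (Set.Icc p (1 / 2)) := by
    apply monotoneOn_of_deriv_nonneg (convex_Icc _ _)
    · exact fun q hq => (hder q hq).continuousAt.continuousWithinAt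
    · exact fun q hq => (hder q (interior_subset hq)).differentiableAt.differentiableWithinAt
    · intro q hq
      have hq' := interior_subset hq
      rw [(hder q hq').deriv, sub_nonneg]
      have hq0 : 0 < q := by linarith [hq'.1]
      have h2 := hq'.2
      apply sin_tangent_value_le hb0 hb (by apply div_nonneg hK; linarith)
      · exact div_le_div_of_nonneg_left hK hq0 (by linarith)
      · have : K / q ≤ K / p := div_le_div_of_nonneg_left hK hp0 hq'.1
        linarith
  have h := hmono ⟨le_rfl, hp⟩ ⟨hp, le_rfl⟩ hp
  refine h.trans_eq ?_
  simp only
  rw [show K / (1 / 2) = 2 * K by ring, show K / (1 - 1 / 2) = 2 * K by ring, sin_add, sin_sub]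
  ring

/-! ### Means of the sine along an antitone function. -/

section antitone

variable {m : ℝ → ℝ}

open Real

theorem Antitone.intervalIntegrable_sin (hm : Antitone m) (s t : ℝ) :
    IntervalIntegrable (fun u => sin (π * m u)) MeasureTheory.volume s t := by
  rw [intervalIntegrable_iff, Set.uIoc]
  apply MeasureTheory.Integrable.of_bound (C := 1)
  · exact (measurable_sin.comp (hm.measurable.const_mul π)).aestronglyMeasurable
  · filter_upwards with u using by simpa using abs_sin_le_one _

theorem Antitone.max_sub (hm : Antitone m) (a : ℝ) : Antitone fun u => max (m u - a) 0 :=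
  fun _ _ h => max_le_max (sub_le_sub_right (hm h) a) le_rfl

/-- Beyond a jump of size D the sine lies below the extended chords of `sin_chord`. As m has mean a,
its excess above a and its deficit below a have the same integral, and the two chords combine into a
second difference of the sine. -/
theorem integral_sin_le_of_jump (hm : Antitone m) (h0 : ∀ u, 0 ≤ m u) (h1 : ∀ u, m u ≤ 1)
    {a D M : ℝ} (ha : ∫ u in (0 : ℝ)..1, m u = a) (hD : 0 < D)
    (hjump : ∀ u ∈ Set.Ioo (0 : ℝ) 1, m u = a ∨ D ≤ |m u - a|)
    (hM : M ≤ ∫ u in (0 : ℝ)..(1 / 2), max (m u - a) 0) :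
    ∫ u in (0 : ℝ)..1, sin (π * m u) ≤ (1 - 2 * (M / D) * (1 - cos (π * D))) * sin (π * a) := by
  have ha0 : 0 ≤ a := ha ▸ intervalIntegral.integral_nonneg zero_le_one fun u _ => h0 u
  have ha1 : a ≤ 1 := by
    rw [← ha]
    calc _ ≤ ∫ u in (0 : ℝ)..1, (1 : ℝ) := intervalIntegral.integral_mono_on zero_le_one
          hm.intervalIntegrable (by simp) fun u _ => h1 u
      _ = 1 := by simp
  have hpi := pi_pos
  have b0 : 0 ≤ π * a := by positivity
  have b1 : π * a ≤ π := by nlinarith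
  set N := ∫ u in (0 : ℝ)..1, max (m u - a) 0 with hN
  have hi : ∀ s t, IntervalIntegrable (fun u => max (m u - a) 0) MeasureTheory.volume s t :=
    fun s t => (hm.max_sub a).intervalIntegrable
  have hMN : M ≤ N := by
    refine hM.trans ?_
    rw [hN, ← intervalIntegral.integral_add_adjacent_intervals (hi 0 (1 / 2)) (hi (1 / 2) 1)]
    have : 0 ≤ ∫ u in (1 / 2 : ℝ)..1, max (m u - a) 0 :=
      intervalIntegral.integral_nonneg (by norm_num) fun u _ => le_max_right _ _
    linarith
  -- `c1` and `-c2` are the slopes of the chords for jumps up and down.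
  set c1 := (sin (π * a + π * D) - sin (π * a)) / D with hc1
  set c2 := (sin (π * a + -(π * D)) - sin (π * a)) / D with hc2
  -- The deficit is written as the excess minus m - a, whose integral vanishes; only `c1 + c2`
  -- survives the integration.
  have hpt : ∀ u ∈ Set.Ioo (0 : ℝ) 1, sin (π * m u) ≤ (sin (π * a) - c2 * a * (-1)) +
      ((c1 + c2) * max (m u - a) 0 - c2 * m u) := by
    intro u hu
    rcases hjump u hu with h | h
    · rw [h]; simp
    · rcases le_total 0 (m u - a) with h' | h'
      · rw [abs_of_nonneg h'] at h
        have := sin_chord (b := π * a) (D := π * D) (T := π * (m u - a)) b0 b1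
          (by nlinarith [h0 u]) (by nlinarith [h1 u]) (q := (m u - a) / D)
          (by rwa [le_div_iff₀ hD, one_mul]) (by field_simp)
        rw [max_eq_left h']
        rw [show π * a + π * (m u - a) = π * m u by ring] at this
        have e : (m u - a) / D * (sin (π * a + π * D) - sin (π * a)) = (m u - a) * c1 := by
          rw [hc1]; ring
        rw [e] at this
        linarith
      · rw [abs_of_nonpos h'] at h
        have := sin_chord (b := π * a) (D := -(π * D)) (T := π * (m u - a)) b0 b1
          (by nlinarith [h0 u]) (by nlinarith [h1 u]) (q := -(m u - a) / D)
          (by rwa [le_div_iff₀ hD, one_mul]) (by field_simp)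
        rw [max_eq_right h']
        rw [show π * a + π * (m u - a) = π * m u by ring] at this
        have e : -(m u - a) / D * (sin (π * a + -(π * D)) - sin (π * a)) = -(m u - a) * c2 := by
          rw [hc2]; ring
        rw [e] at this
        linarith
  have hint : IntervalIntegrable (fun u => (c1 + c2) * max (m u - a) 0 - c2 * m u)
      MeasureTheory.volume 0 1 :=
    ((hi 0 1).const_mul _).sub (hm.intervalIntegrable.const_mul _)
  have hle := intervalIntegral.integral_mono_on_of_le_Ioo zero_le_one (hm.intervalIntegrable_sin 0 1)
    ((intervalIntegrable_const (c := sin (π * a) - c2 * a * (-1))).add hint) hpt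
  rw [intervalIntegral.integral_add intervalIntegrable_const hint, intervalIntegral.integral_sub
    ((hi 0 1).const_mul _) (hm.intervalIntegrable.const_mul _),
    intervalIntegral.integral_const_mul, intervalIntegral.integral_const_mul, ha, ← hN,
    intervalIntegral.integral_const] at hle
  have e3 : c1 + c2 = -(2 / D * (1 - cos (π * D)) * sin (π * a)) := by
    rw [hc1, hc2, sin_add, sin_add, cos_neg, sin_neg]; ring
  rw [e3] at hle
  have h5 : 0 ≤ 2 / D * (1 - cos (π * D)) * sin (π * a) := by
    have := cos_le_one (π * D)
    exact mul_nonneg (mul_nonneg (by positivity) (by linarith)) (sin_nonneg_of_nonneg_of_le_pi b0 b1)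
  have e4 : (1 - 2 * (M / D) * (1 - cos (π * D))) * sin (π * a) =
      sin (π * a) - 2 / D * (1 - cos (π * D)) * sin (π * a) * M := by ring
  rw [e4]
  have := mul_le_mul_of_nonneg_left hMN h5
  simp only [smul_eq_mul] at hle
  linarith

/-- Jensen's inequality for the sine. -/
theorem Antitone.integral_sin_le (hm : Antitone m) (h0 : ∀ u, 0 ≤ m u) (h1 : ∀ u, m u ≤ 1)
    {s t : ℝ} (hst : s < t) :
    ∫ u in s..t, sin (π * m u) ≤ (t - s) * sin (π * ((∫ u in s..t, m u) / (t - s))) := by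
  have hts : 0 < t - s := sub_pos.2 hst
  set x := (∫ u in s..t, m u) / (t - s) with hx
  have hx0 : 0 ≤ x := div_nonneg (intervalIntegral.integral_nonneg hst.le fun u _ => h0 u) hts.le
  have hx1 : x ≤ 1 := by
    rw [hx, div_le_one hts]
    calc _ ≤ ∫ u in s..t, (1 : ℝ) := intervalIntegral.integral_mono_on hst.le
          hm.intervalIntegrable (by simp) fun u _ => h1 u
      _ = t - s := by simp
  have hpi := pi_pos
  have hint : IntervalIntegrable (fun u => cos (π * x) * π * m u) MeasureTheory.volume s t :=
    hm.intervalIntegrable.const_mul _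
  calc ∫ u in s..t, sin (π * m u)
      ≤ ∫ u in s..t, ((sin (π * x) - cos (π * x) * π * x) + cos (π * x) * π * m u) := by
        refine intervalIntegral.integral_mono_on hst.le (hm.intervalIntegrable_sin s t)
          (intervalIntegrable_const.add hint) fun u _ => ?_
        have := sin_le_tangent (r := π * x) (s := π * m u) (by positivity) (by nlinarith)
          (by have := h0 u; positivity) (by nlinarith [h1 u])
        linarith
    _ = (t - s) * sin (π * x) := by
        rw [intervalIntegral.integral_add intervalIntegrable_const hint,
          intervalIntegral.integral_const, intervalIntegral.integral_const_mul, smul_eq_mul]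
        have : ∫ u in s..t, m u = x * (t - s) := by rw [hx]; field_simp
        rw [this]; ring

/-- Jensen's inequality on either side of the crossing point p replaces m by two values, a + M/p
with weight p and a - M/(1-p) with weight 1 - p. Since only levels up to 1/2 count, p ≤ 1/2, and
`two_point_sin_le` shows that the worst case is p = 1/2. -/
theorem integral_sin_le_of_half (hm : Antitone m) (h0 : ∀ u, 0 ≤ m u) (h1 : ∀ u, m u ≤ 1)
    {a ψ : ℝ} (ha : ∫ u in (0 : ℝ)..1, m u = a) (ha2 : a ≤ 1 / 2) (hψ : 0 < ψ)
    (hM : ψ ≤ ∫ u in (0 : ℝ)..(1 / 2), max (m u - a) 0) :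
    ∫ u in (0 : ℝ)..1, sin (π * m u) ≤ cos (2 * π * ψ) * sin (π * a) := by
  have hpi := pi_pos
  have ha0 : 0 ≤ a := ha ▸ intervalIntegral.integral_nonneg zero_le_one fun u _ => h0 u
  have hi : ∀ s t, IntervalIntegrable (fun u => max (m u - a) 0) MeasureTheory.volume s t :=
    fun s t => (hm.max_sub a).intervalIntegrable
  have hmi : ∀ s t, IntervalIntegrable m MeasureTheory.volume s t :=
    fun s t => hm.intervalIntegrable
  -- the point where `m` crosses `a`, or `1 / 2` if that comes first
  obtain ⟨p, hp0, hp, hpM⟩ : ∃ p : ℝ, 0 ≤ p ∧ p ≤ 1 / 2 ∧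
      ∫ u in (0 : ℝ)..(1 / 2), max (m u - a) 0 = ∫ u in (0 : ℝ)..p, (m u - a) := by
    -- The point 0 is admitted unconditionally so that the supremum is over a nonempty set.
    set S := {u : ℝ | 0 ≤ u ∧ u ≤ 1 / 2 ∧ (u = 0 ∨ a ≤ m u)} with hS
    have hS0 : (0 : ℝ) ∈ S := ⟨le_rfl, by norm_num, Or.inl rfl⟩
    have hSb : BddAbove S := ⟨1 / 2, fun u hu => hu.2.1⟩
    have hp0 : 0 ≤ sSup S := le_csSup hSb hS0
    have hp : sSup S ≤ 1 / 2 := csSup_le ⟨0, hS0⟩ fun u hu => hu.2.1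
    refine ⟨sSup S, hp0, hp, ?_⟩
    rw [← intervalIntegral.integral_add_adjacent_intervals (hi 0 (sSup S)) (hi (sSup S) (1 / 2))]
    have e1 : ∫ u in (0 : ℝ)..(sSup S), max (m u - a) 0 = ∫ u in (0 : ℝ)..(sSup S), (m u - a) := by
      refine intervalIntegral.integral_congr_Ioo_of_le hp0 fun u hu => ?_
      obtain ⟨v, hv, huv⟩ := exists_lt_of_lt_csSup ⟨0, hS0⟩ hu.2
      have : a ≤ m v := hv.2.2.resolve_left (by linarith [hu.1])
      exact max_eq_left (by linarith [hm huv.le])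
    have e2 : ∫ u in (sSup S)..(1 / 2), max (m u - a) 0 = ∫ u in (sSup S)..(1 / 2), (0 : ℝ) := by
      refine intervalIntegral.integral_congr_Ioo_of_le hp fun u hu => ?_
      apply max_eq_right
      by_contra hc
      exact absurd (le_csSup hSb ⟨by linarith [hu.1], hu.2.le, Or.inr (by linarith)⟩)
        (not_le.2 hu.1)
    rw [e1, e2]; simp
  rw [hpM] at hM
  set M := ∫ u in (0 : ℝ)..p, (m u - a) with hMdef
  have hp0 : 0 < p := by
    rcases hp0.lt_or_eq with h | h
    · exact h
    · rw [hMdef, ← h] at hM; simp at hM; linarith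
  have hM1 : ∫ u in (0 : ℝ)..p, m u = M + p * a := by
    rw [hMdef, intervalIntegral.integral_sub (hmi _ _) intervalIntegrable_const]; simp
  have hM2 : ∫ u in p..1, m u = (1 - p) * a - M := by
    have := intervalIntegral.integral_add_adjacent_intervals (hmi 0 p) (hmi p 1)
    rw [ha, hM1] at this; linarith
  have hp1 : 0 < 1 - p := by linarith
  have hx : M + p * a ≤ p := by
    rw [← hM1]
    calc _ ≤ ∫ u in (0 : ℝ)..p, (1 : ℝ) := intervalIntegral.integral_mono_on hp0.le
          hm.intervalIntegrable (by simp) fun u _ => h1 u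
      _ = p := by simp
  have hy : 0 ≤ (1 - p) * a - M :=
    hM2 ▸ intervalIntegral.integral_nonneg (by linarith) fun u _ => h0 u
  have hMpos : 0 < M := hψ.trans_le hM
  calc ∫ u in (0 : ℝ)..1, sin (π * m u)
      = (∫ u in (0 : ℝ)..p, sin (π * m u)) + ∫ u in p..1, sin (π * m u) :=
        (intervalIntegral.integral_add_adjacent_intervals (hm.intervalIntegrable_sin 0 p)
          (hm.intervalIntegrable_sin p 1)).symm
    _ ≤ p * sin (π * a + π * M / p) + (1 - p) * sin (π * a - π * M / (1 - p)) := by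
        have t1 := hm.integral_sin_le h0 h1 hp0
        have t2 := hm.integral_sin_le h0 h1 (show p < 1 by linarith)
        rw [hM1] at t1
        rw [hM2] at t2
        refine (add_le_add t1 t2).trans_eq ?_
        rw [sub_zero, show π * ((M + p * a) / p) = π * a + π * M / p by field_simp; ring,
          show π * (((1 - p) * a - M) / (1 - p)) = π * a - π * M / (1 - p) by field_simp]
    _ ≤ sin (π * a) * cos (2 * (π * M)) := by
        refine two_point_sin_le (by positivity) (by nlinarith) (by positivity) hp0 hp ?_
        rw [show π * a + π * M / p = π * ((M + p * a) / p) by field_simp; ring]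
        have : (M + p * a) / p ≤ 1 := by rwa [div_le_one hp0]
        nlinarith
    _ ≤ cos (2 * π * ψ) * sin (π * a) := by
        rw [mul_comm]
        refine mul_le_mul_of_nonneg_right ?_
          (sin_nonneg_of_nonneg_of_le_pi (by positivity) (by nlinarith))
        -- This keeps 2πM within [0, π], where the cosine decreases, so M may be lowered to ψ.
        have hMa : M ≤ 1 / 2 := by nlinarith
        exact cos_le_cos_of_nonneg_of_le_pi (by positivity) (by nlinarith) (by nlinarith)

end antitone

/-! ### Monotone quotients of the sine from Euler's product. -/

section sine_quotients

open Real Filter Topology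

/-- Pairing 1 + z/(j+1) with 1 - z/(j+2) turns each pair into a function of z(1-z) alone, which
makes the symmetry z ↔ 1 - z visible; the two outer factors remain. -/
theorem euler_sin_prod_eq (z : ℝ) (N : ℕ) :
    ∏ j ∈ Finset.range (N + 1), (1 - z ^ 2 / ((j : ℝ) + 1) ^ 2) =
      (1 - z) * (1 + z / (N + 1)) *
        ∏ j ∈ Finset.range N, (1 + z * (1 - z) / (((j : ℝ) + 1) * (j + 2))) := by
  induction N with
  | zero => simp; ring
  | succ N ih =>
    rw [Finset.prod_range_succ, ih, Finset.prod_range_succ _ N]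
    push_cast
    field_simp
    ring

/-- In the limit sin(πz)/(πz(1-z)) is a product of factors increasing in z(1-z), and z₀ ≤ z ≤ 1 - z₀
gives z₀(1-z₀) ≤ z(1-z). The comparison already holds for the finite products, since the leftover
factor 1 + z/(N+1) increases too. -/
theorem mul_one_sub_mul_sin_le {z₀ z : ℝ} (h0 : 0 ≤ z₀) (h : z₀ ≤ z) (h1 : z ≤ 1 - z₀) :
    z * (1 - z) * sin (π * z₀) ≤ z₀ * (1 - z₀) * sin (π * z) := by
  have t := fun z => (tendsto_euler_sin_prod z).comp (tendsto_add_atTop_nat 1)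
  refine le_of_tendsto_of_tendsto' ((t z₀).const_mul _) ((t z).const_mul _) fun N => ?_
  simp only [Function.comp, euler_sin_prod_eq]
  have hs : z₀ * (1 - z₀) ≤ z * (1 - z) := by nlinarith
  have hs0 : 0 ≤ z₀ * (1 - z₀) := mul_nonneg h0 (by linarith)
  have hp : ∏ j ∈ Finset.range N, (1 + z₀ * (1 - z₀) / (((j : ℝ) + 1) * (j + 2))) ≤
      ∏ j ∈ Finset.range N, (1 + z * (1 - z) / (((j : ℝ) + 1) * (j + 2))) :=
    Finset.prod_le_prod (fun j _ => by positivity) fun j _ => by gcongr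
  have hq : 0 ≤ ∏ j ∈ Finset.range N, (1 + z₀ * (1 - z₀) / (((j : ℝ) + 1) * (j + 2))) :=
    Finset.prod_nonneg fun j _ => by positivity
  have hr : (1 + z₀ / (N + 1)) * ∏ j ∈ Finset.range N, (1 + z₀ * (1 - z₀) / (((j : ℝ) + 1) * (j + 2)))
      ≤ (1 + z / (N + 1)) * ∏ j ∈ Finset.range N, (1 + z * (1 - z) / (((j : ℝ) + 1) * (j + 2))) := by
    have : 0 ≤ z := h0.trans h
    gcongr
  have hc : 0 ≤ z * (1 - z) * (z₀ * (1 - z₀)) * π :=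
    mul_nonneg (mul_nonneg (hs0.trans hs) hs0) pi_pos.le
  have := mul_le_mul_of_nonneg_left hr hc
  linarith

theorem sin_mul_le_mul_sin {z₀ z : ℝ} (h0 : 0 < z₀) (h : z₀ ≤ z) (h1 : z ≤ 1) :
    z₀ * sin (π * z) ≤ z * sin (π * z₀) := by
  have hpi := pi_pos
  have := sin_chord (b := 0) (D := π * z₀) (T := π * z) le_rfl hpi.le (by nlinarith) (by nlinarith)
    (q := z / z₀) (by rwa [le_div_iff₀ h0, one_mul]) (by field_simp)
  simp only [zero_add, sin_zero, sub_zero] at this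
  have h2 := mul_le_mul_of_nonneg_left this h0.le
  rwa [← mul_assoc, mul_div_cancel₀ _ h0.ne'] at h2

end sine_quotients

/-! ### Superlevel sets and the greedy choice behind the modified expansion. -/

noncomputable section levels

open Real Finset

variable {V : Type u} [Fintype V]

/-- The superlevel set of `h` at height `u`. -/
def superlevel (h : V → ℝ) (u : ℝ) : Finset V := univ.filter fun y => u ≤ h y

theorem mem_superlevel {h : V → ℝ} {u : ℝ} {y : V} : y ∈ superlevel h u ↔ u ≤ h y := by
  simp [superlevel]

theorem superlevel_antitone (h : V → ℝ) : Antitone (superlevel h) := fun _ _ hst _ hy =>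
  mem_superlevel.2 (hst.trans (mem_superlevel.1 hy))

theorem antitone_indicator_le (h : ℝ) : Antitone fun u : ℝ => if u ≤ h then (1 : ℝ) else 0 := by
  intro s t hst
  by_cases ht : t ≤ h
  · simp [ht, hst.trans ht]
  · simp only [ht, if_false]
    split_ifs <;> norm_num

theorem integral_indicator_le {h s : ℝ} (h0 : 0 ≤ h) (hs : 0 ≤ s) :
    ∫ u in (0 : ℝ)..s, (if u ≤ h then (1 : ℝ) else 0) = min h s := by
  have hi : ∀ a b : ℝ, IntervalIntegrable (fun u : ℝ => if u ≤ h then (1 : ℝ) else 0)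
      MeasureTheory.volume a b := fun a b => (antitone_indicator_le h).intervalIntegrable
  have hm0 : 0 ≤ min h s := le_min h0 hs
  rw [← intervalIntegral.integral_add_adjacent_intervals (hi 0 (min h s)) (hi (min h s) s)]
  have e1 : ∫ u in (0 : ℝ)..(min h s), (if u ≤ h then (1 : ℝ) else 0) =
      ∫ u in (0 : ℝ)..(min h s), (1 : ℝ) :=
    intervalIntegral.integral_congr_Ioo_of_le hm0 fun u hu =>
      if_pos (hu.2.le.trans (min_le_left _ _))
  have e2 : ∫ u in (min h s)..s, (if u ≤ h then (1 : ℝ) else 0) =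
      ∫ u in (min h s)..s, (0 : ℝ) := by
    refine intervalIntegral.integral_congr_Ioo_of_le (min_le_right _ _) fun u hu => if_neg ?_
    intro hc
    have : u ≤ min h s := le_min hc hu.2.le
    exact absurd hu.1 (not_lt.2 this)
  rw [e1, e2]; simp

variable (p h : V → ℝ)

theorem sum_superlevel (u : ℝ) :
    ∑ y ∈ superlevel h u, p y = ∑ y, p y * (if u ≤ h y then 1 else 0) := by
  simp [superlevel, Finset.sum_filter]

variable {p h}

theorem antitone_sum_superlevel (hp : ∀ y, 0 ≤ p y) :
    Antitone fun u => ∑ y ∈ superlevel h u, p y := fun _ _ hst =>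
  sum_le_sum_of_subset_of_nonneg (superlevel_antitone h hst) fun y _ _ => hp y

theorem integral_sum_superlevel (h0 : ∀ y, 0 ≤ h y) (h1 : ∀ y, h y ≤ 1) :
    ∫ u in (0 : ℝ)..1, ∑ y ∈ superlevel h u, p y = ∑ y, p y * h y := by
  simp only [sum_superlevel]
  rw [intervalIntegral.integral_finsetSum fun y _ =>
    (antitone_indicator_le (h y)).intervalIntegrable.const_mul _]
  refine sum_congr rfl fun y _ => ?_
  rw [intervalIntegral.integral_const_mul, integral_indicator_le (h0 y) zero_le_one,
    min_eq_left (h1 y)]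

/-- A sublevel set of `h` with mass just below `c`, up to ties. -/
theorem exists_sublevel_greedy [DecidableEq V] {c : ℝ} (hc0 : 0 ≤ c) (hc : c < ∑ y, p y) :
    ∃ (B : Finset V) (v : V), v ∉ B ∧ ∑ y ∈ B, p y ≤ c ∧ c < ∑ y ∈ insert v B, p y ∧
      (∀ b ∈ B, h b ≤ h v) ∧ ∀ z ∉ B, h v ≤ h z := by
  classical
  -- Among the sets closed downwards for `h` with mass at most c, one of maximal cardinality is
  -- taken; adding a lowest outside point must then overshoot c.
  let F := univ.filter fun B : Finset V =>
    (∀ b ∈ B, ∀ z ∉ B, h b ≤ h z) ∧ ∑ y ∈ B, p y ≤ c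
  have hF : F.Nonempty := ⟨∅, by simp [F, hc0]⟩
  obtain ⟨B, hB, hmax⟩ := exists_max_image F Finset.card hF
  simp only [F, mem_filter, mem_univ, true_and] at hB hmax
  have hne : (Bᶜ).Nonempty := by
    rw [nonempty_iff_ne_empty, Ne, compl_eq_empty_iff]
    rintro rfl
    linarith [hB.2]
  obtain ⟨v, hv, hmin⟩ := exists_min_image Bᶜ h hne
  rw [mem_compl] at hv
  have hmin' : ∀ z ∉ B, h v ≤ h z := fun z hz => hmin z (mem_compl.2 hz)
  refine ⟨B, v, hv, hB.2, ?_, fun b hb => hB.1 b hb v hv, hmin'⟩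
  by_contra hcon
  have := hmax (insert v B) ⟨?_, not_lt.1 hcon⟩
  · rw [card_insert_of_notMem hv] at this; omega
  · intro b hb z hz
    rw [mem_insert, not_or] at hz
    rcases mem_insert.1 hb with rfl | hb
    · exact hmin' z hz.2
    · exact hB.1 b hb z hz.2

/-- Up to the level θ every point outside B still belongs to the superlevel set, so the excess over
1 - c is at least the part of B that survives plus c minus the mass of B. Integrating over [0, θ]
produces the left side; levels between θ and 1/2 only add to the right side. -/
theorem greedy_sum_le_integral [DecidableEq V] (hp : ∀ y, 0 ≤ p y) (hs : ∑ y, p y = 1) (h0 : ∀ y, 0 ≤ h y)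
    {B : Finset V} {v : V} {c : ℝ} (hB : ∀ b ∈ B, h b ≤ h v)
    (hBc : ∀ z ∉ B, h v ≤ h z) :
    ∑ y ∈ B, p y * min (h y) (1 / 2) + (c - ∑ y ∈ B, p y) * min (h v) (1 / 2) ≤
      ∫ u in (0 : ℝ)..(1 / 2), max (∑ y ∈ superlevel h u, p y - (1 - c)) 0 := by
  set θ := min (h v) (1 / 2) with hθ
  have hθ0 : 0 ≤ θ := le_min (h0 v) (by norm_num)
  have hθ1 : θ ≤ 1 / 2 := min_le_right _ _
  have hi : ∀ s t, IntervalIntegrable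
      (fun u => max (∑ y ∈ superlevel h u, p y - (1 - c)) 0) MeasureTheory.volume s t :=
    fun s t => ((antitone_sum_superlevel hp).max_sub _).intervalIntegrable
  have hind : ∀ y ∈ B, IntervalIntegrable (fun u : ℝ => p y * if u ≤ h y then (1 : ℝ) else 0)
      MeasureTheory.volume 0 θ :=
    fun y _ => (antitone_indicator_le (h y)).intervalIntegrable.const_mul _
  have hsum : IntervalIntegrable (fun u : ℝ => ∑ y ∈ B, p y * if u ≤ h y then (1 : ℝ) else 0)
      MeasureTheory.volume 0 θ := by
    simpa only [Finset.sum_fn] using IntervalIntegrable.sum B hind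
  calc ∑ y ∈ B, p y * min (h y) (1 / 2) + (c - ∑ y ∈ B, p y) * θ
      = ∫ u in (0 : ℝ)..θ, ((∑ y ∈ B, p y * if u ≤ h y then (1 : ℝ) else 0)
          + (c - ∑ y ∈ B, p y)) := by
        rw [intervalIntegral.integral_add hsum intervalIntegrable_const,
          intervalIntegral.integral_finsetSum hind, intervalIntegral.integral_const]
        congr 1
        · refine sum_congr rfl fun y hy => ?_
          rw [intervalIntegral.integral_const_mul, integral_indicator_le (h0 y) hθ0, hθ,
            ← min_assoc, min_eq_left (hB y hy)]
        · rw [sub_zero, smul_eq_mul, mul_comm]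
    _ ≤ ∫ u in (0 : ℝ)..θ, max (∑ y ∈ superlevel h u, p y - (1 - c)) 0 := by
        refine intervalIntegral.integral_mono_on hθ0 (hsum.add intervalIntegrable_const) (hi _ _)
          fun u hu => le_max_of_le_left ?_
        have e : ∑ y ∈ superlevel h u, p y =
            (∑ y ∈ B, p y * if u ≤ h y then (1 : ℝ) else 0) + ∑ y ∈ Bᶜ, p y := by
          rw [sum_superlevel, ← sum_add_sum_compl B]
          congr 1
          refine sum_congr rfl fun y hy => ?_
          rw [if_pos, mul_one]
          exact hu.2.trans ((min_le_left _ _).trans (hBc y (mem_compl.1 hy)))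
        have e2 := sum_add_sum_compl B p
        rw [e]; linarith
    _ ≤ _ := by
        rw [← intervalIntegral.integral_add_adjacent_intervals (hi 0 θ) (hi θ (1 / 2))]
        have : 0 ≤ ∫ u in θ..(1 / 2), max (∑ y ∈ superlevel h u, p y - (1 - c)) 0 :=
          intervalIntegral.integral_nonneg hθ1 fun u _ => le_max_right _ _
        linarith

theorem measurableSet_superlevel_eq (h : V → ℝ) (B : Finset V) :
    MeasurableSet {u | superlevel h u = B} := by
  classical
  have : {u | superlevel h u = B} = ⋂ y, if y ∈ B then Set.Iic (h y) else Set.Ioi (h y) := by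
    ext u
    simp only [Set.mem_ofPred_eq, Set.mem_iInter, Finset.ext_iff, mem_superlevel]
    refine forall_congr' fun y => ?_
    by_cases hy : y ∈ B <;> simp [hy]
  rw [this]
  refine MeasurableSet.iInter fun y => ?_
  split_ifs
  exacts [measurableSet_Iic, measurableSet_Ioi]

/-- Integrals over the superlevel sets of `h` are finite sums. -/
theorem exists_superlevel_weights (h : V → ℝ) :
    ∃ w : Finset V → ℝ, (∀ B, 0 ≤ w B) ∧ ∀ φ : Finset V → ℝ,
      ∑ B, w B * φ B = ∫ u in (0 : ℝ)..1, φ (superlevel h u) := by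
  classical
  -- The weight of B is the Lebesgue measure of the levels whose superlevel set is B.
  refine ⟨fun B => ∫ u in (0 : ℝ)..1, Set.indicator {u | superlevel h u = B} (fun _ => (1 : ℝ)) u,
    fun B => intervalIntegral.integral_nonneg zero_le_one fun u _ =>
      Set.indicator_nonneg (fun _ _ => zero_le_one) _, fun φ => ?_⟩
  have hi : ∀ B, IntervalIntegrable (Set.indicator {u | superlevel h u = B} fun _ => (1 : ℝ))
      MeasureTheory.volume 0 1 := fun B => by
    rw [intervalIntegrable_iff, Set.uIoc]
    exact (MeasureTheory.integrable_const (1 : ℝ)).indicator (measurableSet_superlevel_eq h B)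
  simp only [← intervalIntegral.integral_mul_const]
  rw [← intervalIntegral.integral_finsetSum fun B _ => (hi B).mul_const _]
  refine intervalIntegral.integral_congr fun u _ => ?_
  simp [Set.indicator_apply]

end levels

/-! ### From contraction of the sine to convergence and eigenvalue bounds. -/

noncomputable section contraction

open Real Finset

variable {V : Type u} [Fintype V]

/-- `P` is a stochastic matrix with the positive stationary distribution `p`. -/
structure IsStationaryPair (P : Matrix V V ℝ) (p : V → ℝ) : Prop where
  nonneg : ∀ x y, 0 ≤ P x y
  row_sum : ∀ x, ∑ y, P x y = 1
  pos : ∀ x, 0 < p x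
  sum_eq_one : ∑ x, p x = 1
  stationary : ∀ y, ∑ x, p x * P x y = p y

/-- The density, with respect to `p`, of one step of the chain started from `p` restricted to `A`. -/
def stepDensity (P : Matrix V V ℝ) (p : V → ℝ) (A : Finset V) (y : V) : ℝ :=
  (∑ x ∈ A, p x * P x y) / p y

/-- One step of the evolving sets of `P` contracts the sine of the measure by `1 - κ`. -/
def SineContraction (P : Matrix V V ℝ) (p : V → ℝ) (κ : ℝ) : Prop :=
  ∀ A : Finset V, A.Nonempty → ∑ x ∈ A, p x ≤ 1 / 2 →
    ∫ u in (0 : ℝ)..1, sin (π * ∑ y ∈ superlevel (stepDensity P p A) u, p y) ≤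
      (1 - κ) * sin (π * ∑ x ∈ A, p x)

variable {P : Matrix V V ℝ} {p : V → ℝ}

namespace IsStationaryPair

variable (hP : IsStationaryPair P p)
include hP

theorem stepDensity_nonneg (A : Finset V) (y : V) : 0 ≤ stepDensity P p A y :=
  div_nonneg (sum_nonneg fun x _ => mul_nonneg (hP.pos x).le (hP.nonneg x y)) (hP.pos y).le

theorem mul_stepDensity (A : Finset V) (y : V) :
    p y * stepDensity P p A y = ∑ x ∈ A, p x * P x y := by
  rw [stepDensity, mul_div_cancel₀ _ (hP.pos y).ne']

theorem stepDensity_compl [DecidableEq V] (A : Finset V) (y : V) :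
    stepDensity P p Aᶜ y = 1 - stepDensity P p A y := by
  rw [eq_sub_iff_add_eq, stepDensity, stepDensity, ← add_div, add_comm, sum_add_sum_compl,
    hP.stationary, div_self (hP.pos y).ne']

theorem stepDensity_le_one (A : Finset V) (y : V) : stepDensity P p A y ≤ 1 := by
  classical
  linarith [hP.stepDensity_compl A y, hP.stepDensity_nonneg Aᶜ y]

theorem sum_mul_stepDensity (A : Finset V) : ∑ y, p y * stepDensity P p A y = ∑ x ∈ A, p x := by
  simp only [hP.mul_stepDensity]
  rw [sum_comm]
  simp [← mul_sum, hP.row_sum]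

theorem sum_nonneg (A : Finset V) : 0 ≤ ∑ x ∈ A, p x := Finset.sum_nonneg fun x _ => (hP.pos x).le

theorem sum_compl [DecidableEq V] (A : Finset V) : ∑ x ∈ Aᶜ, p x = 1 - ∑ x ∈ A, p x := by
  rw [eq_sub_iff_add_eq, add_comm, sum_add_sum_compl, hP.sum_eq_one]

theorem sum_le_one (A : Finset V) : ∑ x ∈ A, p x ≤ 1 := by
  classical
  linarith [hP.sum_compl A, hP.sum_nonneg Aᶜ]

theorem sin_nonneg (A : Finset V) : 0 ≤ sin (π * ∑ x ∈ A, p x) :=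
  sin_nonneg_of_nonneg_of_le_pi (mul_nonneg pi_pos.le (hP.sum_nonneg A))
    (mul_le_of_le_one_right pi_pos.le (hP.sum_le_one A))

theorem integral_superlevel_stepDensity (A : Finset V) :
    ∫ u in (0 : ℝ)..1, ∑ y ∈ superlevel (stepDensity P p A) u, p y = ∑ x ∈ A, p x := by
  rw [integral_sum_superlevel (hP.stepDensity_nonneg A) (hP.stepDensity_le_one A),
    hP.sum_mul_stepDensity]

/-- A nonempty set of measure at most `1 / 2`. -/
theorem exists_sum_le_half [Nontrivial V] : ∃ A : Finset V, A.Nonempty ∧ ∑ x ∈ A, p x ≤ 1 / 2 := by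
  classical
  obtain ⟨x, y, hxy⟩ := exists_pair_ne V
  have h := hP.sum_le_one {x, y}
  rw [sum_pair hxy] at h
  rcases le_total (p x) (p y) with h' | h'
  · exact ⟨{x}, singleton_nonempty x, by rw [sum_singleton]; linarith⟩
  · exact ⟨{y}, singleton_nonempty y, by rw [sum_singleton]; linarith⟩

/-- The contracted mean is nonnegative and some set has a positive sine. Iterating the contraction
needs this sign. -/
theorem one_sub_nonneg_of_sineContraction [Nontrivial V] {κ : ℝ} (hκ : SineContraction P p κ) :
    0 ≤ 1 - κ := by
  obtain ⟨A, hA, hA2⟩ := hP.exists_sum_le_half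
  have h := hκ A hA hA2
  have h0 : 0 < ∑ x ∈ A, p x := sum_pos (fun x _ => hP.pos x) hA
  have h1 : 0 < sin (π * ∑ x ∈ A, p x) :=
    sin_pos_of_pos_of_lt_pi (by have := pi_pos; positivity) (by nlinarith [pi_pos])
  have h2 := (intervalIntegral.integral_nonneg (μ := MeasureTheory.volume) zero_le_one
    fun u _ => hP.sin_nonneg (superlevel (stepDensity P p A) u)).trans h
  exact nonneg_of_mul_nonneg_left h2 h1

/-- For measure above 1/2 the weights are those of the complement, transported by complementation:
the sine is unchanged and a density d becomes 1 - d, which is where the total mass 1 in `key` is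
needed. The weights need not sum to one: the empty set is given none. -/
theorem exists_step_weights [DecidableEq V] {κ : ℝ} (hκ : SineContraction P p κ) (A : Finset V) :
    ∃ w : Finset V → ℝ, (∀ B, 0 ≤ w B) ∧
      (∀ y, ∑ B, w B * (if y ∈ B then 1 else 0) = stepDensity P p A y) ∧
      ∑ B, w B * sin (π * ∑ x ∈ B, p x) ≤ (1 - κ) * sin (π * ∑ x ∈ A, p x) := by
  have key : ∀ A : Finset V, A.Nonempty → ∑ x ∈ A, p x ≤ 1 / 2 →
      ∃ w : Finset V → ℝ, (∀ B, 0 ≤ w B) ∧ ∑ B, w B = 1 ∧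
      (∀ y, ∑ B, w B * (if y ∈ B then 1 else 0) = stepDensity P p A y) ∧
      ∑ B, w B * sin (π * ∑ x ∈ B, p x) ≤ (1 - κ) * sin (π * ∑ x ∈ A, p x) := by
    intro A hA hA2
    obtain ⟨w, hw0, hw⟩ := exists_superlevel_weights (stepDensity P p A)
    refine ⟨w, hw0, by simpa using hw fun _ => 1, fun y => ?_, ?_⟩
    · rw [hw]
      simp only [mem_superlevel]
      rw [integral_indicator_le (hP.stepDensity_nonneg A y) zero_le_one,
        min_eq_left (hP.stepDensity_le_one A y)]
    · rw [hw]; exact hκ A hA hA2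
  rcases A.eq_empty_or_nonempty with rfl | hA
  · refine ⟨fun _ => 0, fun _ => le_rfl, fun y => ?_, ?_⟩ <;> simp [stepDensity]
  rcases le_total (∑ x ∈ A, p x) (1 / 2) with hA2 | hA2
  · obtain ⟨w, h1, -, h2⟩ := key A hA hA2
    exact ⟨w, h1, h2⟩
  rcases eq_or_ne A univ with rfl | hAu
  · refine ⟨fun B => if B = univ then 1 else 0, fun B => by positivity, fun y => ?_, ?_⟩
    · simp only [ite_mul, one_mul, zero_mul, sum_ite_eq', mem_univ, if_true, stepDensity,
        hP.stationary, div_self (hP.pos y).ne']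
    · simp [hP.sum_eq_one]
  have hAc : (Aᶜ).Nonempty := by rwa [nonempty_iff_ne_empty, Ne, compl_eq_empty_iff]
  obtain ⟨w, h1, h2, h3, h4⟩ := key Aᶜ hAc (by rw [hP.sum_compl]; linarith)
  have hsin : ∀ B : Finset V, sin (π * ∑ x ∈ Bᶜ, p x) = sin (π * ∑ x ∈ B, p x) := fun B => by
    rw [hP.sum_compl, mul_sub, mul_one, sin_pi_sub]
  have hcompl : ∀ φ : Finset V → ℝ, ∑ B, w Bᶜ * φ B = ∑ B, w B * φ Bᶜ := fun φ =>
    Fintype.sum_bijective compl compl_bijective _ _ fun B => by rw [compl_compl]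
  refine ⟨fun B => w Bᶜ, fun B => h1 _, fun y => ?_, ?_⟩
  · rw [hcompl]
    have h5 := h3 y
    rw [hP.stepDensity_compl] at h5
    have : ∑ B, w B * (if y ∈ Bᶜ then 1 else 0) =
        ∑ B, w B - ∑ B, w B * (if y ∈ B then 1 else 0) := by
      rw [← sum_sub_distrib]
      refine sum_congr rfl fun B _ => ?_
      by_cases hy : y ∈ B <;> simp [hy]
    rw [this, h2, h5]; ring
  · rw [hcompl]
    simp only [hsin] at h4 ⊢
    exact h4

/-- Duality with the chain: t steps of evolving sets started at {x} contain y with weight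
p(x)P^t(x,y)/p(y). Each step contributes one factor 1 - κ. -/
theorem exists_pow_weights [DecidableEq V] [Nontrivial V] {κ : ℝ} (hκ : SineContraction P p κ)
    (x : V) (t : ℕ) :
    ∃ w : Finset V → ℝ, (∀ B, 0 ≤ w B) ∧
      (∀ y, ∑ B, w B * (if y ∈ B then p y else 0) = p x * (P ^ t) x y) ∧
      ∑ B, w B * sin (π * ∑ x ∈ B, p x) ≤ (1 - κ) ^ t * sin (π * p x) := by
  induction t with
  | zero =>
    refine ⟨fun B => if B = {x} then 1 else 0, fun B => by positivity, fun y => ?_, ?_⟩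
    · simp only [ite_mul, one_mul, zero_mul, sum_ite_eq', mem_univ, if_true, mem_singleton,
        pow_zero, Matrix.one_apply]
      by_cases h : y = x
      · simp [h]
      · simp [h, Ne.symm h]
    · simp
  | succ t ih =>
    obtain ⟨w, h1, h2, h3⟩ := ih
    choose W W1 W2 W3 using hP.exists_step_weights hκ
    refine ⟨fun C => ∑ B, w B * W B C, fun C => Finset.sum_nonneg fun B _ =>
      mul_nonneg (h1 B) (W1 B C), fun y => ?_, ?_⟩
    · simp only [sum_mul]
      rw [sum_comm]
      have e1 : ∀ B, ∑ C, w B * W B C * (if y ∈ C then p y else 0) =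
          ∑ z, P z y * (w B * if z ∈ B then p z else 0) := by
        intro B
        have := hP.mul_stepDensity B y
        rw [← W2 B y, mul_sum] at this
        calc _ = w B * ∑ C, p y * (W B C * if y ∈ C then 1 else 0) := by
              rw [mul_sum]
              refine sum_congr rfl fun C _ => ?_
              split_ifs <;> ring
          _ = _ := by
              rw [this, mul_sum, ← sum_filter_add_sum_filter_not univ (· ∈ B)]
              simp only [filter_mem_eq_inter, univ_inter]
              rw [add_eq_left.2]
              · refine sum_congr rfl fun z hz => ?_
                rw [if_pos hz]; ring
              · refine sum_eq_zero fun z hz => ?_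
                rw [if_neg (mem_filter.1 hz).2]; ring
      simp only [e1]
      rw [sum_comm]
      simp only [← mul_sum, h2]
      rw [pow_succ, Matrix.mul_apply, mul_sum]
      exact sum_congr rfl fun z _ => by ring
    · simp only [sum_mul]
      rw [sum_comm]
      calc _ = ∑ B, w B * ∑ C, W B C * sin (π * ∑ x ∈ C, p x) := by
            refine sum_congr rfl fun B _ => ?_
            rw [mul_sum]
            exact sum_congr rfl fun C _ => by ring
        _ ≤ ∑ B, w B * ((1 - κ) * sin (π * ∑ x ∈ B, p x)) :=
            sum_le_sum fun B _ => mul_le_mul_of_nonneg_left (W3 B) (h1 B)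
        _ = (1 - κ) * ∑ B, w B * sin (π * ∑ x ∈ B, p x) := by
            rw [mul_sum]
            exact sum_congr rfl fun C _ => by ring
        _ ≤ (1 - κ) * ((1 - κ) ^ t * sin (π * p x)) :=
            mul_le_mul_of_nonneg_left h3 (hP.one_sub_nonneg_of_sineContraction hκ)
        _ = _ := by ring

theorem pow_row_sum [DecidableEq V] (t : ℕ) (x : V) : ∑ y, (P ^ t) x y = 1 := by
  induction t with
  | zero => simp [Matrix.one_apply]
  | succ t ih =>
    simp only [pow_succ, Matrix.mul_apply]
    rw [sum_comm]
    simp [← mul_sum, hP.row_sum, ih]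

theorem sum_mul_abs_indicator_sub [DecidableEq V] (B : Finset V) :
    ∑ y, |(if y ∈ B then p y else 0) - p y * ∑ x ∈ B, p x| =
      2 * ((∑ x ∈ B, p x) * (1 - ∑ x ∈ B, p x)) := by
  set s := ∑ x ∈ B, p x with hs
  have hs0 := hP.sum_nonneg B
  have hs1 := hP.sum_le_one B
  rw [← sum_add_sum_compl B]
  have e1 : ∀ y ∈ B, |(if y ∈ B then p y else 0) - p y * s| = p y * (1 - s) := fun y hy => by
    rw [if_pos hy, abs_of_nonneg] <;> nlinarith [hP.pos y]
  have e2 : ∀ y ∈ Bᶜ, |(if y ∈ B then p y else 0) - p y * s| = p y * s := fun y hy => by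
    rw [if_neg (mem_compl.1 hy), zero_sub, abs_neg, abs_of_nonneg]
    exact mul_nonneg (hP.pos y).le hs0
  rw [sum_congr rfl e1, sum_congr rfl e2, ← sum_mul, ← sum_mul, hP.sum_compl, ← hs]
  ring

/-- Geometric convergence in total variation from a contraction of the sine. -/
theorem sum_abs_pow_sub_le [DecidableEq V] [Nontrivial V] {κ : ℝ} (hκ : SineContraction P p κ)
    {q : ℝ} (hq0 : 0 < q) (hq : ∀ x, q ≤ p x) (x : V) (t : ℕ) :
    ∑ y, |(P ^ t) x y - p y| ≤ 2 * ((1 - q) * (1 - κ) ^ t) := by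
  obtain ⟨w, h1, h2, h3⟩ := hP.exists_pow_weights hκ x t
  have hpx := hP.pos x
  have hpx1 : p x ≤ 1 := by simpa using hP.sum_le_one {x}
  have hmass : ∑ B, w B * ∑ z ∈ B, p z = p x := by
    calc _ = ∑ B, ∑ y, w B * (if y ∈ B then p y else 0) := by
          refine sum_congr rfl fun B _ => ?_
          rw [← mul_sum, sum_ite_mem, univ_inter]
      _ = p x := by
          rw [sum_comm]
          simp only [h2]
          rw [← mul_sum, hP.pow_row_sum, mul_one]
  have hq1 : q < 1 := by
    obtain ⟨z, hz⟩ := exists_ne x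
    have := hP.sum_le_one {x, z}
    rw [sum_pair hz.symm] at this
    linarith [hq x, hP.pos z]
  have hsq : 0 < sin (π * q) :=
    sin_pos_of_pos_of_lt_pi (mul_pos pi_pos hq0) (by nlinarith [pi_pos])
  -- Both sides vanish for the empty and the full set; every other set has measure in [q, 1 - q].
  have hquot : ∀ B : Finset V, (∑ z ∈ B, p z) * (1 - ∑ z ∈ B, p z) * sin (π * q) ≤
      q * (1 - q) * sin (π * ∑ z ∈ B, p z) := by
    intro B
    rcases B.eq_empty_or_nonempty with rfl | ⟨z, hz⟩
    · simp
    rcases eq_or_ne B univ with rfl | hB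
    · simp [hP.sum_eq_one]
    obtain ⟨z', hz'⟩ : ∃ z', z' ∉ B := by
      by_contra hc; push Not at hc; exact hB (eq_univ_iff_forall.2 hc)
    have g1 : p z ≤ ∑ z ∈ B, p z := single_le_sum (fun x _ => (hP.pos x).le) hz
    have g2 : p z' ≤ ∑ z ∈ Bᶜ, p z :=
      single_le_sum (fun x _ => (hP.pos x).le) (mem_compl.2 hz')
    rw [hP.sum_compl] at g2
    exact mul_one_sub_mul_sin_le hq0.le ((hq z).trans g1) (by linarith [hq z'])
  -- The weights satisfy ∑ w(B) p(B) = p(x), so p(x)(P^t(x,·) - p) is the weighted sum of p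
  -- restricted to B minus p(B) p, and the triangle inequality applies set by set.
  have hmain : p x * ∑ y, |(P ^ t) x y - p y| ≤
      2 * ∑ B, w B * ((∑ z ∈ B, p z) * (1 - ∑ z ∈ B, p z)) := by
    calc p x * ∑ y, |(P ^ t) x y - p y|
        = ∑ y, |∑ B, w B * ((if y ∈ B then p y else 0) - p y * ∑ z ∈ B, p z)| := by
          rw [mul_sum]
          refine sum_congr rfl fun y _ => ?_
          rw [← abs_of_pos hpx, ← abs_mul]
          congr 1
          simp only [mul_sub, sum_sub_distrib, h2]
          congr 1
          rw [← hmass, sum_mul]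
          exact sum_congr rfl fun B _ => by ring
      _ ≤ ∑ y, ∑ B, w B * |(if y ∈ B then p y else 0) - p y * ∑ z ∈ B, p z| := by
          refine sum_le_sum fun y _ => (abs_sum_le_sum_abs _ _).trans_eq ?_
          exact sum_congr rfl fun B _ => by rw [abs_mul, abs_of_nonneg (h1 B)]
      _ = _ := by
          rw [sum_comm, mul_sum]
          refine sum_congr rfl fun B _ => ?_
          rw [← mul_sum, hP.sum_mul_abs_indicator_sub]; ring
  have h4 : (∑ B, w B * ((∑ z ∈ B, p z) * (1 - ∑ z ∈ B, p z))) * sin (π * q) ≤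
      p x * (1 - q) * (1 - κ) ^ t * sin (π * q) := by
    calc _ = ∑ B, w B * ((∑ z ∈ B, p z) * (1 - ∑ z ∈ B, p z) * sin (π * q)) := by
          rw [sum_mul]; exact sum_congr rfl fun B _ => by ring
      _ ≤ ∑ B, w B * (q * (1 - q) * sin (π * ∑ z ∈ B, p z)) :=
          sum_le_sum fun B _ => mul_le_mul_of_nonneg_left (hquot B) (h1 B)
      _ = q * (1 - q) * ∑ B, w B * sin (π * ∑ z ∈ B, p z) := by
          rw [mul_sum]; exact sum_congr rfl fun B _ => by ring
      _ ≤ q * (1 - q) * ((1 - κ) ^ t * sin (π * p x)) :=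
          mul_le_mul_of_nonneg_left h3 (mul_nonneg hq0.le (by linarith))
      _ = (1 - q) * (1 - κ) ^ t * (q * sin (π * p x)) := by ring
      -- As sin(πz)/z decreases, the starting point x may be replaced by the lower bound q; this
      -- leaves the constant 1 - q.
      _ ≤ (1 - q) * (1 - κ) ^ t * (p x * sin (π * q)) :=
          mul_le_mul_of_nonneg_left (sin_mul_le_mul_sin hq0 (hq x) hpx1)
            (mul_nonneg (by linarith) (pow_nonneg (hP.one_sub_nonneg_of_sineContraction hκ) t))
      _ = _ := by ring
  have h5 := le_of_mul_le_mul_right h4 hsq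
  refine le_of_mul_le_mul_left ?_ hpx
  linarith

/-- The mean of an eigenvector for an eigenvalue other than one vanishes. -/
theorem sum_mul_eigenvector_eq_zero {z : ℂ} {v : V → ℂ}
    (hv : ∀ x, ∑ y, (P x y : ℂ) * v y = z * v x) (hz : z ≠ 1) : ∑ x, (p x : ℂ) * v x = 0 := by
  have h : z * ∑ x, (p x : ℂ) * v x = ∑ x, (p x : ℂ) * v x := by
    calc z * ∑ x, (p x : ℂ) * v x = ∑ x, (p x : ℂ) * ∑ y, (P x y : ℂ) * v y := by
          rw [mul_sum]
          refine sum_congr rfl fun x _ => ?_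
          rw [hv]; ring
      _ = ∑ y, (∑ x, (p x : ℂ) * (P x y : ℂ)) * v y := by
          simp only [mul_sum, sum_mul]
          rw [sum_comm]
          exact sum_congr rfl fun x _ => sum_congr rfl fun y _ => by ring
      _ = _ := by
          refine sum_congr rfl fun y _ => ?_
          congr 1
          exact_mod_cast hP.stationary y
  have : (z - 1) * ∑ x, (p x : ℂ) * v x = 0 := by rw [sub_mul, h]; ring
  exact (mul_eq_zero.1 this).resolve_left (sub_ne_zero.2 hz)

omit hP in
theorem pow_mulVec_eigenvector [DecidableEq V] {z : ℂ} {v : V → ℂ}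
    (hv : ∀ x, ∑ y, (P x y : ℂ) * v y = z * v x) (t : ℕ) (x : V) :
    ∑ y, ((P ^ t) x y : ℂ) * v y = z ^ t * v x := by
  induction t generalizing x with
  | zero => simp [Matrix.one_apply, apply_ite Complex.ofReal]
  | succ t ih =>
    calc ∑ y, ((P ^ (t + 1)) x y : ℂ) * v y
        = ∑ a, ((P ^ t) x a : ℂ) * ∑ y, (P a y : ℂ) * v y := by
          simp only [pow_succ, Matrix.mul_apply, Complex.ofReal_sum, Complex.ofReal_mul, sum_mul,
            mul_sum]
          rw [sum_comm]
          exact sum_congr rfl fun x _ => sum_congr rfl fun y _ => by ring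
      _ = z * ∑ a, ((P ^ t) x a : ℂ) * v a := by
          simp only [hv, mul_sum]
          exact sum_congr rfl fun x _ => by ring
      _ = _ := by rw [ih]; ring

omit hP in
/-- Eigenvectors of mean zero bound the distance to stationarity from below. -/
theorem exists_norm_pow_le [DecidableEq V] {z : ℂ} {v : V → ℂ}
    (hv : ∀ x, ∑ y, (P x y : ℂ) * v y = z * v x) (hv0 : v ≠ 0)
    (hmean : ∑ x, (p x : ℂ) * v x = 0) :
    ∃ x, ∀ t : ℕ, ‖z‖ ^ t ≤ ∑ y, |(P ^ t) x y - p y| := by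
  obtain ⟨x₀, hx₀⟩ := Function.ne_iff.1 hv0
  -- A state maximizing the modulus of the eigenvector serves for all t at once, as the limit in
  -- `norm_eigenvalue_le` requires.
  obtain ⟨x, -, hx⟩ := exists_max_image univ (fun x => ‖v x‖) ⟨x₀, mem_univ _⟩
  have hvx : 0 < ‖v x‖ := (norm_pos_iff.2 hx₀).trans_le (hx x₀ (mem_univ _))
  refine ⟨x, fun t => le_of_mul_le_mul_right ?_ hvx⟩
  calc ‖z‖ ^ t * ‖v x‖ = ‖∑ y, (((P ^ t) x y - p y : ℝ) : ℂ) * v y‖ := by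
        simp only [Complex.ofReal_sub, sub_mul, sum_sub_distrib, hmean, sub_zero,
          pow_mulVec_eigenvector hv, norm_mul, norm_pow]
    _ ≤ ∑ y, |(P ^ t) x y - p y| * ‖v y‖ := by
        refine (norm_sum_le _ _).trans_eq ?_
        exact sum_congr rfl fun y _ => by rw [norm_mul, Complex.norm_real, Real.norm_eq_abs]
    _ ≤ ∑ y, |(P ^ t) x y - p y| * ‖v x‖ :=
        sum_le_sum fun y hy => mul_le_mul_of_nonneg_left (hx y hy) (abs_nonneg _)
    _ = _ := by rw [sum_mul]

/-- Otherwise ((1-κ)/‖z‖)^t would tend to zero, while the eigenvector keeps a fixed multiple of it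
at least 1. -/
theorem norm_eigenvalue_le [DecidableEq V] [Nontrivial V] {κ : ℝ} (hκ : SineContraction P p κ)
    {z : ℂ} {v : V → ℂ} (hv : ∀ x, ∑ y, (P x y : ℂ) * v y = z * v x) (hv0 : v ≠ 0)
    (hmean : ∑ x, (p x : ℂ) * v x = 0) : ‖z‖ ≤ 1 - κ := by
  obtain ⟨x, hx⟩ := exists_norm_pow_le hv hv0 hmean
  obtain ⟨x₀, -, hx₀⟩ := exists_min_image univ p ⟨x, mem_univ _⟩
  have hr := hP.one_sub_nonneg_of_sineContraction hκ
  by_contra hc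
  rw [not_le] at hc
  have hz : 0 < ‖z‖ := hr.trans_lt hc
  have ht := (tendsto_pow_atTop_nhds_zero_of_lt_one (div_nonneg hr hz.le)
    ((div_lt_one hz).2 hc)).const_mul (2 * (1 - p x₀))
  rw [mul_zero] at ht
  obtain ⟨t, ht⟩ := (ht.eventually_lt_const one_pos).exists
  have h := (hx t).trans (hP.sum_abs_pow_sub_le hκ (hP.pos x₀) (fun y => hx₀ y (mem_univ _)) x t)
  rw [div_pow, ← mul_div_assoc, div_lt_one (pow_pos hz t)] at ht
  linarith

end IsStationaryPair

end contraction

/-! ### The bounds for mixing time, eigenvalues and spectral gap. -/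

namespace FiniteMarkovChain

noncomputable section

open Finset

variable {V : Type u} [Fintype V] [DecidableEq V] (M : FiniteMarkovChain V)

theorem stat_pow (t : ℕ) (y : V) : ∑ x, M.stat x * (M.P ^ t) x y = M.stat y := by
  induction t generalizing y with
  | zero => simp [Matrix.one_apply]
  | succ t ih =>
    simp only [pow_succ, Matrix.mul_apply, mul_sum]
    rw [sum_comm]
    simp only [← mul_assoc, ← sum_mul, ih, M.stationary]

theorem pow_nonneg (t : ℕ) (x y : V) : 0 ≤ (M.P ^ t) x y := by
  induction t generalizing y with
  | zero => simp only [pow_zero, Matrix.one_apply]; positivity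
  | succ t ih =>
    rw [pow_succ, Matrix.mul_apply]
    exact sum_nonneg fun z _ => mul_nonneg (ih z) (M.P_nonneg z y)

theorem stat_pos (y : V) : 0 < M.stat y := by
  obtain ⟨x, -, hx⟩ : ∃ x ∈ univ, 0 < M.stat x := by
    by_contra! hc
    have := sum_nonpos hc
    rw [M.stat_sum] at this
    linarith
  obtain ⟨t, ht⟩ := M.irreducible x y
  rw [← M.stat_pow t y]
  exact sum_pos' (fun z _ => mul_nonneg (M.stat_nonneg z) (M.pow_nonneg t z y))
    ⟨x, mem_univ _, mul_pos hx ht⟩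

theorem isStationaryPair : IsStationaryPair M.P M.stat :=
  ⟨M.P_nonneg, M.P_row_sum, M.stat_pos, M.stat_sum, M.stationary⟩

theorem meas_compl (A : Finset V) : M.meas Aᶜ = 1 - M.meas A := M.isStationaryPair.sum_compl A

theorem meas_nonneg (A : Finset V) : 0 ≤ M.meas A := M.isStationaryPair.sum_nonneg A

theorem meas_le_one (A : Finset V) : M.meas A ≤ 1 := M.isStationaryPair.sum_le_one A

theorem meas_pos {A : Finset V} (hA : A.Nonempty) : 0 < M.meas A :=
  sum_pos (fun x _ => M.stat_pos x) hA

theorem flow_nonneg (A B : Finset V) : 0 ≤ M.flow A B :=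
  sum_nonneg fun x _ => sum_nonneg fun y _ => mul_nonneg (M.stat_nonneg x) (M.P_nonneg x y)

theorem hatFlow_nonneg (A : Finset V) (x : V) : 0 ≤ M.hatFlow A x :=
  le_min (M.flow_nonneg _ _) (by linarith [M.stat_nonneg x])

theorem hatFlow_eq (A : Finset V) (x : V) :
    M.hatFlow A x = M.stat x * min (stepDensity M.P M.stat A x) (1 / 2) := by
  rw [mul_min_of_nonneg _ _ (M.stat_nonneg x), M.isStationaryPair.mul_stepDensity, hatFlow, flow]
  simp [div_eq_mul_inv]

theorem hatPsi_bound_nonneg {A B : Finset V} {v : V} (hB : M.meas B ≤ M.meas Aᶜ) :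
    0 ≤ ∑ x ∈ B, M.hatFlow A x + (M.meas Aᶜ - M.meas B) / M.stat v * M.hatFlow A v :=
  add_nonneg (sum_nonneg fun x _ => M.hatFlow_nonneg A x)
    (mul_nonneg (div_nonneg (by linarith) (M.stat_nonneg v)) (M.hatFlow_nonneg A v))

theorem hatPsi_nonneg (A : Finset V) : 0 ≤ M.hatPsi A := by
  refine Real.sInf_nonneg ?_
  rintro r ⟨B, v, hB, -, rfl⟩
  exact M.hatPsi_bound_nonneg hB

theorem hatPsi_le {A B : Finset V} {v : V} (hB : M.meas B ≤ M.meas Aᶜ)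
    (hv : M.meas Aᶜ < M.meas (insert v B)) :
    M.hatPsi A ≤
      ∑ x ∈ B, M.hatFlow A x + (M.meas Aᶜ - M.meas B) / M.stat v * M.hatFlow A v := by
  refine csInf_le ⟨0, ?_⟩ ⟨B, v, hB, hv, rfl⟩
  rintro r ⟨B, v, hB, -, rfl⟩
  exact M.hatPsi_bound_nonneg hB

theorem hatPsiMin_nonneg : 0 ≤ M.hatPsiMin := by
  refine Real.sInf_nonneg ?_
  rintro r ⟨A, -, -, rfl⟩
  exact M.hatPsi_nonneg A

theorem hatPsiMin_le {A : Finset V} (hA : A.Nonempty) (hA2 : M.meas A ≤ 1 / 2) :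
    M.hatPsiMin ≤ M.hatPsi A := by
  refine csInf_le ⟨0, ?_⟩ ⟨A, hA, hA2, rfl⟩
  rintro r ⟨A, -, -, rfl⟩
  exact M.hatPsi_nonneg A

/-- The modified edge expansion is at most the expected growth of the evolving set at levels below
`1 / 2`. -/
theorem hatPsi_le_integral {A : Finset V} (hA : A.Nonempty) :
    M.hatPsi A ≤ ∫ u in (0 : ℝ)..(1 / 2),
      max (∑ y ∈ superlevel (stepDensity M.P M.stat A) u, M.stat y - M.meas A) 0 := by
  have hc : M.meas Aᶜ < ∑ y, M.stat y := by
    rw [M.stat_sum, M.meas_compl]; linarith [M.meas_pos hA]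
  obtain ⟨B, v, -, h1, h2, h3, h4⟩ := exists_sublevel_greedy (h := stepDensity M.P M.stat A)
    (M.meas_nonneg Aᶜ) hc
  refine (M.hatPsi_le h1 h2).trans ?_
  have h := greedy_sum_le_integral (c := M.meas Aᶜ) M.stat_nonneg M.stat_sum
    (M.isStationaryPair.stepDensity_nonneg A) h3 h4
  rw [show (1 : ℝ) - M.meas Aᶜ = M.meas A by rw [M.meas_compl]; ring] at h
  simp only [hatFlow_eq]
  rw [← mul_assoc, div_mul_cancel₀ _ (M.stat_pos v).ne']
  exact h

theorem hatPsiMin_le_integral {A : Finset V} (hA : A.Nonempty) (hA2 : M.meas A ≤ 1 / 2) :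
    M.hatPsiMin ≤ ∫ u in (0 : ℝ)..(1 / 2),
      max (∑ y ∈ superlevel (stepDensity M.P M.stat A) u, M.stat y - M.meas A) 0 :=
  (M.hatPsiMin_le hA hA2).trans (M.hatPsi_le_integral hA)

theorem hatPsiMin_le_half [Nontrivial V] : M.hatPsiMin ≤ 1 / 2 := by
  obtain ⟨A, hA, hA2⟩ := M.isStationaryPair.exists_sum_le_half
  refine (M.hatPsiMin_le_integral hA hA2).trans ?_
  calc _ ≤ ∫ u in (0 : ℝ)..(1 / 2), (1 : ℝ) := by
        refine intervalIntegral.integral_mono_on (by norm_num)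
          ((antitone_sum_superlevel M.stat_nonneg).max_sub _).intervalIntegrable
          intervalIntegrable_const fun u _ => max_le ?_ zero_le_one
        linarith [M.meas_nonneg A,
          M.isStationaryPair.sum_le_one (superlevel (stepDensity M.P M.stat A) u)]
    _ = 1 / 2 := by simp

theorem deltaMin_le {A B : Finset V} (h : M.meas A ≠ M.meas B) :
    M.deltaMin ≤ |M.meas A - M.meas B| := by
  refine csInf_le ⟨0, ?_⟩ ⟨A, B, h, rfl⟩
  rintro r ⟨A, B, -, rfl⟩
  exact abs_nonneg _

theorem exists_deltaMin_eq :
    ∃ A B : Finset V, M.meas A ≠ M.meas B ∧ M.deltaMin = |M.meas A - M.meas B| := by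
  refine Set.Nonempty.csInf_mem (s := {r : ℝ | ∃ A B : Finset V, M.meas A ≠ M.meas B ∧
    r = |M.meas A - M.meas B|}) ⟨_, ∅, univ, ?_, rfl⟩ ?_
  · simp [meas, M.stat_sum]
  · refine (Set.finite_range fun q : Finset V × Finset V => |M.meas q.1 - M.meas q.2|).subset ?_
    rintro r ⟨A, B, -, rfl⟩
    exact ⟨(A, B), rfl⟩

theorem deltaMin_pos : 0 < M.deltaMin := by
  obtain ⟨A, B, h, h'⟩ := M.exists_deltaMin_eq
  rw [h']
  exact abs_pos.2 (sub_ne_zero.2 h)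

theorem deltaMin_le_one : M.deltaMin ≤ 1 := by
  have := M.deltaMin_le (A := ∅) (B := univ) (by simp [meas, M.stat_sum])
  simpa [meas, M.stat_sum] using this

theorem hatAMax_pos : 0 < M.hatAMax := lt_max_of_lt_right (by linarith [M.deltaMin_pos])

theorem hatAMax_le_half [Nontrivial V] : M.hatAMax ≤ 1 / 2 :=
  max_le M.hatPsiMin_le_half (by linarith [M.deltaMin_le_one])

theorem hatAMin_div_deltaMin : M.hatAMin / M.deltaMin = M.hatPsiMin / (2 * M.hatAMax) := by
  have h : M.hatAMin * M.hatAMax = M.hatPsiMin * (M.deltaMin / 2) := min_mul_max _ _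
  have h1 := M.deltaMin_pos
  have h2 := M.hatAMax_pos
  rw [div_eq_div_iff h1.ne' (by positivity)]
  linarith

/-- Since min times max is the product of the two, the minimum and `deltaMin` disappear from g.
Positivity and leading order are read off from this form. -/
theorem gapBound_eq : M.gapBound =
    M.hatPsiMin / M.hatAMax * (1 - Real.cos (2 * Real.pi * M.hatAMax)) := by
  rw [gapBound, hatAMin_div_deltaMin]
  have h2 := M.hatAMax_pos
  field_simp

theorem gapBound_pos [Nontrivial V] (h : 0 < M.hatPsiMin) : 0 < M.gapBound := by
  have h1 := M.hatAMax_pos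
  have h2 := M.hatAMax_le_half
  have hpi := Real.pi_pos
  have h3 : Real.cos (2 * Real.pi * M.hatAMax) < 1 := by
    rw [← Real.cos_zero]
    exact Real.cos_lt_cos_of_nonneg_of_le_pi le_rfl (by nlinarith) (by positivity)
  rw [gapBound_eq]
  exact mul_pos (div_pos h h1) (by linarith)

/-- If Ψ̂_min ≤ Δ_min/2, jumps of size Δ_min give g = 2(Ψ̂_min/Δ_min)(1 - cos(πΔ_min)); otherwise
the growth at levels below 1/2 gives g = 1 - cos(2πΨ̂_min). -/
theorem sineContraction_gapBound : SineContraction M.P M.stat M.gapBound := by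
  intro A hA hA2
  have hP := M.isStationaryPair
  have hm : Antitone fun u => ∑ y ∈ superlevel (stepDensity M.P M.stat A) u, M.stat y :=
    antitone_sum_superlevel M.stat_nonneg
  have hψ := M.hatPsiMin_le_integral hA hA2
  have hint := hP.integral_superlevel_stepDensity A
  rcases le_or_gt M.hatPsiMin (M.deltaMin / 2) with h | h
  · refine (integral_sin_le_of_jump hm (fun u => hP.sum_nonneg _) (fun u => hP.sum_le_one _) hint
      M.deltaMin_pos (fun u _ => ?_) hψ).trans_eq ?_
    · rw [or_iff_not_imp_left]
      exact M.deltaMin_le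
    · rw [gapBound, hatAMin, hatAMax, min_eq_left h, max_eq_right h]
      congr 5
      ring
  · refine (integral_sin_le_of_half hm (fun u => hP.sum_nonneg _) (fun u => hP.sum_le_one _) hint
      hA2 (lt_trans (by linarith [M.deltaMin_pos]) h) hψ).trans_eq ?_
    rw [gapBound, hatAMin, hatAMax, min_eq_right h.le, max_eq_left h.le]
    have := M.deltaMin_pos
    field_simp
    ring

theorem statMin_le (x : V) : M.statMin ≤ M.stat x := ciInf_le (Set.finite_range _).bddBelow x

theorem statMin_pos [Nonempty V] : 0 < M.statMin := by
  obtain ⟨x, hx⟩ := exists_eq_ciInf_of_finite (f := M.stat)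
  rw [statMin, ← hx]
  exact M.stat_pos x

theorem statMin_lt_one [Nontrivial V] : M.statMin < 1 := by
  obtain ⟨x, y, hxy⟩ := exists_pair_ne V
  have := M.meas_le_one {x, y}
  rw [meas, sum_pair hxy] at this
  linarith [M.statMin_le x, M.stat_pos y]

theorem tvDist_le [Nontrivial V] (x : V) (t : ℕ) :
    tvDist ((M.P ^ t) x) M.stat ≤ (1 - M.statMin) * (1 - M.gapBound) ^ t := by
  have := M.isStationaryPair.sum_abs_pow_sub_le M.sineContraction_gapBound M.statMin_pos
    M.statMin_le x t
  rw [tvDist]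
  linarith

theorem mixingTime_le {ε : ℝ} {t : ℕ} (h : ∀ x, tvDist ((M.P ^ t) x) M.stat ≤ ε) :
    M.mixingTime ε ≤ t := iInf₂_le t h

theorem gapBound_le_one [Nontrivial V] : M.gapBound ≤ 1 := by
  linarith [M.isStationaryPair.one_sub_nonneg_of_sineContraction M.sineContraction_gapBound]

theorem mixingTime_le_one [Nontrivial V] {ε : ℝ} (hε : 0 < ε) (h : 1 ≤ M.gapBound) :
    M.mixingTime ε ≤ 1 := by
  refine M.mixingTime_le (t := 1) fun x => (M.tvDist_le x 1).trans ?_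
  -- Here g = 1, so the geometric bound already vanishes at t = 1.
  rw [le_antisymm M.gapBound_le_one h]
  simpa using hε.le

theorem mixingTime_le_ceil [Nontrivial V] (hψ : 0 < M.hatPsiMin) {ε : ℝ} (hε : 0 < ε)
    (h : M.gapBound < 1) : M.mixingTime ε ≤
      (⌈1 / (-Real.log (1 - M.gapBound)) * Real.log ((1 - M.statMin) / ε)⌉₊ : ℕ∞) := by
  refine M.mixingTime_le fun x => (M.tvDist_le x _).trans ?_
  set N := ⌈1 / (-Real.log (1 - M.gapBound)) * Real.log ((1 - M.statMin) / ε)⌉₊ with hN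
  have hg := M.gapBound_pos hψ
  have hs : 0 < 1 - M.statMin := by linarith [M.statMin_lt_one]
  have hr : 0 < 1 - M.gapBound := by linarith
  have hlog : 0 < -Real.log (1 - M.gapBound) := by
    linarith [Real.log_neg hr (by linarith)]
  have h1 := Nat.le_ceil (1 / (-Real.log (1 - M.gapBound)) * Real.log ((1 - M.statMin) / ε))
  rw [← hN, one_div, inv_mul_le_iff₀ hlog, Real.log_div hs.ne' hε.ne'] at h1
  rw [← Real.log_le_log_iff (by positivity) hε, Real.log_mul hs.ne' (by positivity), Real.log_pow]
  linarith

/-- Eigenvectors, coordinatewise. -/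
theorem IsEigenvalue.exists_eigenvector {M : FiniteMarkovChain V} {z : ℂ} (h : M.IsEigenvalue z) :
    ∃ v : V → ℂ, v ≠ 0 ∧ ∀ x, ∑ y, (M.P x y : ℂ) * v y = z * v x := by
  obtain ⟨v, hv⟩ := h.exists_hasEigenvector
  refine ⟨v, hv.2, fun x => ?_⟩
  have := congrFun hv.apply_eq_smul x
  simpa [Matrix.toLin'_apply, Matrix.mulVec, dotProduct] using this

theorem gapBound_le_one_sub_norm [Nontrivial V] {z : ℂ} (h : M.IsEigenvalue z) (hz : z ≠ 1) :
    M.gapBound ≤ 1 - ‖z‖ := by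
  obtain ⟨v, hv0, hv⟩ := h.exists_eigenvector
  linarith [M.isStationaryPair.norm_eigenvalue_le M.sineContraction_gapBound hv hv0
    (M.isStationaryPair.sum_mul_eigenvector_eq_zero hv hz)]

/-! ### The spectral gap -/

/-- The transition matrix of the additive symmetrization. -/
def symm : Matrix V V ℝ := (1 / 2 : ℝ) • (M.P + M.reversal)

theorem stat_mul_symm (x y : V) :
    M.stat x * M.symm x y = (M.stat x * M.P x y + M.stat y * M.P y x) / 2 := by
  have := (M.stat_pos x).ne'
  simp only [symm, reversal, Matrix.smul_apply, Matrix.add_apply, Matrix.of_apply, smul_eq_mul]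
  field_simp

theorem symm_nonneg (x y : V) : 0 ≤ M.symm x y := by
  have h := M.stat_mul_symm x y
  have h1 := mul_nonneg (M.stat_nonneg x) (M.P_nonneg x y)
  have h2 := mul_nonneg (M.stat_nonneg y) (M.P_nonneg y x)
  exact nonneg_of_mul_nonneg_right (by rw [h]; linarith) (M.stat_pos x)

theorem symm_row_sum (x : V) : ∑ y, M.symm x y = 1 := by
  have h : M.stat x * ∑ y, M.symm x y = M.stat x * 1 := by
    rw [mul_sum]
    simp only [stat_mul_symm]
    rw [← sum_div, sum_add_distrib, M.stationary, ← mul_sum, M.P_row_sum]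
    ring
  exact mul_left_cancel₀ (M.stat_pos x).ne' h

/-- The lazy version of the additive symmetrization. -/
def lazySymm : Matrix V V ℝ := (1 / 2 : ℝ) • (1 + M.symm)

theorem isStationaryPair_lazySymm : IsStationaryPair M.lazySymm M.stat where
  nonneg x y := by
    have := M.symm_nonneg x y
    simp only [lazySymm, Matrix.smul_apply, Matrix.add_apply, Matrix.one_apply, smul_eq_mul]
    positivity
  row_sum x := by
    simp only [lazySymm, Matrix.smul_apply, Matrix.add_apply, Matrix.one_apply, smul_eq_mul]
    rw [← mul_sum, sum_add_distrib, M.symm_row_sum]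
    simp; norm_num
  pos := M.stat_pos
  sum_eq_one := M.stat_sum
  stationary y := by
    have h : ∀ x, M.stat x * M.lazySymm x y =
        (M.stat x * (if x = y then 1 else 0) + M.stat y * M.symm y x) / 2 := fun x => by
      have e : M.stat y * M.symm y x = M.stat x * M.symm x y := by
        rw [stat_mul_symm, stat_mul_symm]; ring
      rw [e]
      simp only [lazySymm, Matrix.smul_apply, Matrix.add_apply, Matrix.one_apply, smul_eq_mul]
      ring
    simp only [h]
    rw [← sum_div, sum_add_distrib, ← mul_sum, M.symm_row_sum]
    simp

theorem flow_compl_comm (A : Finset V) : M.flow Aᶜ A = M.flow A Aᶜ := by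
  have h1 : M.flow A A + M.flow A Aᶜ = M.meas A := by
    simp only [flow, meas, ← mul_sum, ← sum_add_distrib, ← mul_add, sum_add_sum_compl,
      M.P_row_sum, mul_one]
  have h2 : M.flow A A + M.flow Aᶜ A = M.meas A := by
    rw [flow, flow, sum_add_sum_compl, sum_comm]
    simp only [M.stationary, meas]
  linarith

theorem flowMin_nonneg : 0 ≤ M.flowMin := by
  refine Real.sInf_nonneg ?_
  rintro r ⟨A, -, -, rfl⟩
  exact M.flow_nonneg _ _

theorem flowMin_le {A : Finset V} (hA : A.Nonempty) (hA' : A ≠ univ) :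
    M.flowMin ≤ M.flow A Aᶜ := by
  refine csInf_le ⟨0, ?_⟩ ⟨A, hA, hA', rfl⟩
  rintro r ⟨A, -, -, rfl⟩
  exact M.flow_nonneg _ _

theorem statMin_le_meas_sub {A B : Finset V} (h : A ⊂ B) : M.statMin ≤ M.meas B - M.meas A := by
  obtain ⟨x, hx, hx'⟩ := exists_of_ssubset h
  have h1 : M.meas (insert x A) ≤ M.meas B :=
    sum_le_sum_of_subset_of_nonneg (insert_subset hx h.1) fun y _ _ => M.stat_nonneg y
  simp only [meas, sum_insert hx'] at h1
  have := M.statMin_le x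
  simp only [meas]
  linarith

theorem stepDensity_lazySymm (A : Finset V) (y : V) : stepDensity M.lazySymm M.stat A y =
    ((if y ∈ A then 1 else 0) + stepDensity M.symm M.stat A y) / 2 := by
  have := (M.stat_pos y).ne'
  have e : ∑ x ∈ A, M.stat x * M.lazySymm x y =
      (M.stat y * (if y ∈ A then 1 else 0) + ∑ x ∈ A, M.stat x * M.symm x y) / 2 := by
    have : M.stat y * (if y ∈ A then 1 else 0) = ∑ x ∈ A, M.stat x * (if x = y then 1 else 0) := by
      simp
    rw [this, ← sum_add_distrib, sum_div]
    refine sum_congr rfl fun x _ => ?_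
    simp only [lazySymm, Matrix.smul_apply, Matrix.add_apply, Matrix.one_apply, smul_eq_mul]
    ring
  rw [stepDensity, stepDensity, e]
  field_simp

theorem isStationaryPair_symm : IsStationaryPair M.symm M.stat where
  nonneg := M.symm_nonneg
  row_sum := M.symm_row_sum
  pos := M.stat_pos
  sum_eq_one := M.stat_sum
  stationary y := by
    have h : ∀ x, M.stat x * M.symm x y = M.stat y * M.symm y x := fun x => by
      rw [stat_mul_symm, stat_mul_symm]; ring
    simp only [h]
    rw [← mul_sum, M.symm_row_sum, mul_one]

/-- Laziness makes the density at least 1/2 on A and at most 1/2 off A. Superlevel sets are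
therefore nested with A, so a nonzero jump is at least `statMin`, and the growth at levels below 1/2
is half the flow out of A. -/
theorem sineContraction_lazySymm [Nontrivial V] :
    SineContraction M.lazySymm M.stat (M.spectralGapBound / 2) := by
  intro A hA hA2
  have hP := M.isStationaryPair_lazySymm
  set h := stepDensity M.lazySymm M.stat A with hh
  have hin : ∀ y ∈ A, 1 / 2 ≤ h y := fun y hy => by
    have := M.isStationaryPair_symm.stepDensity_nonneg A y
    rw [hh, stepDensity_lazySymm, if_pos hy]; linarith
  have hout : ∀ y ∉ A, h y ≤ 1 / 2 := fun y hy => by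
    have := M.isStationaryPair_symm.stepDensity_le_one A y
    rw [hh, stepDensity_lazySymm, if_neg hy]; linarith
  have hAu : A ≠ univ := by
    rintro rfl; rw [M.stat_sum] at hA2; norm_num at hA2
  obtain ⟨v, hv, hvmin⟩ := exists_min_image A h hA
  -- With B = Aᶜ the mass is met exactly and the term of `v` drops out.
  have hgreedy := greedy_sum_le_integral (c := M.meas Aᶜ) (B := Aᶜ) (v := v) M.stat_nonneg
    M.stat_sum (hP.stepDensity_nonneg A)
    (fun b hb => (hout b (mem_compl.1 hb)).trans (hin v hv))
    (fun z hz => hvmin z (by simpa using hz))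
  rw [show (1 : ℝ) - M.meas Aᶜ = M.meas A by rw [M.meas_compl]; ring,
    show M.meas Aᶜ - ∑ y ∈ Aᶜ, M.stat y = 0 from sub_self _, zero_mul, add_zero] at hgreedy
  have hflow : ∑ y ∈ Aᶜ, M.stat y * min (h y) (1 / 2) = M.flow A Aᶜ / 2 := by
    have e1 : ∀ y ∈ Aᶜ, M.stat y * min (h y) (1 / 2) =
        ((∑ x ∈ A, M.stat x * M.P x y) + ∑ x ∈ A, M.stat y * M.P y x) / 4 := fun y hy => by
      rw [min_eq_left (hout y (mem_compl.1 hy)), hh, stepDensity_lazySymm,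
        if_neg (mem_compl.1 hy), zero_add, mul_div_assoc',
        M.isStationaryPair_symm.mul_stepDensity, ← sum_add_distrib]
      simp only [stat_mul_symm]
      rw [← sum_div]; ring
    rw [sum_congr rfl e1, ← sum_div, sum_add_distrib, sum_comm]
    have e2 : ∑ y ∈ Aᶜ, ∑ x ∈ A, M.stat y * M.P y x = M.flow Aᶜ A := rfl
    have e3 : ∑ x ∈ A, ∑ y ∈ Aᶜ, M.stat x * M.P x y = M.flow A Aᶜ := rfl
    rw [e2, e3, flow_compl_comm]; ring
  rw [hflow] at hgreedy
  refine (integral_sin_le_of_jump (M := M.flowMin / 2) (D := M.statMin)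
    (antitone_sum_superlevel M.stat_nonneg) (fun u => hP.sum_nonneg _) (fun u => hP.sum_le_one _)
    (hP.integral_superlevel_stepDensity A) M.statMin_pos (fun u _ => ?_) ?_).trans_eq ?_
  · rcases le_or_gt u (1 / 2) with hu | hu
    · have hsub : A ⊆ superlevel h u := fun y hy => mem_superlevel.2 (hu.trans (hin y hy))
      rcases hsub.eq_or_ssubset with he | hs
      · left; rw [← he]
      · right; exact (M.statMin_le_meas_sub hs).trans (le_abs_self _)
    · have hsub : superlevel h u ⊆ A := fun y hy => by
        by_contra hc
        linarith [mem_superlevel.1 hy, hout y hc]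
      rcases hsub.eq_or_ssubset with he | hs
      · left; rw [← hh, he]
      · right; rw [abs_sub_comm]; exact (M.statMin_le_meas_sub hs).trans (le_abs_self _)
  · have := M.flowMin_le hA hAu
    exact le_trans (by linarith) hgreedy
  · rw [spectralGapBound]
    congr 2
    ring

theorem spectralGapBound_nonneg [Nonempty V] : 0 ≤ M.spectralGapBound :=
  mul_nonneg (div_nonneg (mul_nonneg zero_le_two M.flowMin_nonneg) M.statMin_pos.le)
    (by linarith [Real.cos_le_one (Real.pi * M.statMin)])

/-- The lazy chain has the eigenvalue (1 + μ)/2, whose distance to 1 is (1 - μ)/2; this offsets the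
factor 1/2 in `sineContraction_lazySymm`. -/
theorem spectralGapBound_le_one_sub [Nontrivial V] {μ : ℝ}
    (h : Module.End.HasEigenvalue (Matrix.toLin' M.symm) μ) (hμ : μ ≠ 1) :
    M.spectralGapBound ≤ 1 - μ := by
  obtain ⟨v, hv⟩ := h.exists_hasEigenvector
  have hv' : ∀ x, ∑ y, M.symm x y * v y = μ * v x := fun x => by
    simpa [Matrix.toLin'_apply, Matrix.mulVec, dotProduct] using congrFun hv.apply_eq_smul x
  have hlazy : ∀ x, ∑ y, (M.lazySymm x y : ℂ) * (v y : ℂ) = (((1 + μ) / 2 : ℝ) : ℂ) * (v x : ℂ) := by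
    intro x
    norm_cast
    have e : ∀ y, M.lazySymm x y * v y =
        ((if x = y then v y else 0) + M.symm x y * v y) / 2 := fun y => by
      simp only [lazySymm, Matrix.smul_apply, Matrix.add_apply, Matrix.one_apply, smul_eq_mul]
      split_ifs <;> ring
    simp only [e]
    rw [← sum_div, sum_add_distrib, hv']
    simp; ring
  have hP := M.isStationaryPair_lazySymm
  have hne : (fun x => (v x : ℂ)) ≠ 0 := fun hc => hv.2 (funext fun x => by
    simpa using congrFun hc x)
  have h1 : (((1 + μ) / 2 : ℝ) : ℂ) ≠ 1 := by
    norm_cast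
    intro hc; exact hμ (by linarith)
  have h2 := hP.norm_eigenvalue_le M.sineContraction_lazySymm hlazy hne
    (hP.sum_mul_eigenvector_eq_zero hlazy h1)
  rw [Complex.norm_real] at h2
  linarith [le_abs_self ((1 + μ) / 2), Real.norm_eq_abs ((1 + μ) / 2)]

/-- The symmetrization of `symm` as a Hermitian matrix. -/
def hermSymm : Matrix V V ℝ :=
  Matrix.of fun x y => Real.sqrt (M.stat x) * M.symm x y / Real.sqrt (M.stat y)

theorem hermSymm_isHermitian : M.hermSymm.IsHermitian := by
  ext x y
  have hx := M.stat_pos x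
  have hy := M.stat_pos y
  have h := M.stat_mul_symm x y
  have h' := M.stat_mul_symm y x
  have sx := Real.sqrt_pos.2 hx
  have sy := Real.sqrt_pos.2 hy
  have ex := Real.mul_self_sqrt hx.le
  have ey := Real.mul_self_sqrt hy.le
  simp only [hermSymm, Matrix.conjTranspose_apply, Matrix.of_apply, star_trivial]
  rw [div_eq_div_iff sx.ne' sy.ne']
  calc _ = (Real.sqrt (M.stat y) * Real.sqrt (M.stat y)) * M.symm y x := by ring
    _ = (Real.sqrt (M.stat x) * Real.sqrt (M.stat x)) * M.symm x y := by rw [ex, ey, h, h']; ring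
    _ = _ := by ring

theorem hasEigenvalue_symm {μ : ℝ} {w : V → ℝ} (hw : w ≠ 0)
    (h : M.hermSymm.mulVec w = μ • w) : Module.End.HasEigenvalue (Matrix.toLin' M.symm) μ := by
  refine Module.End.hasEigenvalue_of_hasEigenvector (x := fun x => w x / Real.sqrt (M.stat x))
    (Module.End.hasEigenvector_iff.2 ⟨Module.End.mem_eigenspace_iff.2 ?_, fun h0 => hw ?_⟩)
  · ext x
    have hx := congrFun h x
    have sx := Real.sqrt_pos.2 (M.stat_pos x)
    simp only [Matrix.mulVec, dotProduct, hermSymm, Matrix.of_apply, Pi.smul_apply,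
      smul_eq_mul] at hx
    simp only [Matrix.toLin'_apply, Matrix.mulVec, dotProduct, Pi.smul_apply, smul_eq_mul]
    rw [mul_div_assoc', eq_div_iff sx.ne', ← hx, sum_mul]
    exact sum_congr rfl fun y _ => by ring
  · ext x
    have := congrFun h0 x
    have sx := Real.sqrt_pos.2 (M.stat_pos x)
    simpa [sx.ne'] using this

/-- A Hermitian matrix with all eigenvalues 1 is the identity. This makes the infimum defining the
spectral gap range over a nonempty set. -/
theorem exists_eigenvalue_symm_ne_one (h : ∃ x y, x ≠ y ∧ M.symm x y ≠ 0) :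
    ∃ μ : ℝ, μ ≠ 1 ∧ Module.End.HasEigenvalue (Matrix.toLin' M.symm) μ := by
  by_contra! hc
  have hT := M.hermSymm_isHermitian
  have heig : ∀ i, hT.eigenvalues i = 1 := by
    intro i
    by_contra hi
    refine hc _ hi (M.hasEigenvalue_symm (fun h0 => ?_) (hT.mulVec_eigenvectorBasis i))
    exact hT.eigenvectorBasis.orthonormal.ne_zero i (by ext x; exact congrFun h0 x)
  have hone : M.hermSymm = 1 := by
    have hs := hT.spectral_theorem
    have : (RCLike.ofReal ∘ hT.eigenvalues : V → ℝ) = fun _ => 1 := by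
      ext i; simp [heig]
    rw [this, Matrix.diagonal_one, map_one] at hs
    exact hs
  obtain ⟨x, y, hxy, hne⟩ := h
  have := congrFun (congrFun hone x) y
  rw [Matrix.one_apply_ne hxy, hermSymm, Matrix.of_apply] at this
  have sx := Real.sqrt_pos.2 (M.stat_pos x)
  have sy := Real.sqrt_pos.2 (M.stat_pos y)
  exact (div_ne_zero (mul_ne_zero sx.ne' hne) sy.ne') this

theorem spectralGap_eq : M.spectralGap = sInf {r : ℝ | ∃ μ : ℝ, μ ≠ 1 ∧
    Module.End.HasEigenvalue (Matrix.toLin' M.symm) μ ∧ r = 1 - μ} := rfl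

theorem spectralGap_le [Nontrivial V] {μ : ℝ} (hμ : μ ≠ 1)
    (h : Module.End.HasEigenvalue (Matrix.toLin' M.symm) μ) : M.spectralGap ≤ 1 - μ := by
  rw [spectralGap_eq]
  refine csInf_le ⟨M.spectralGapBound, ?_⟩ ⟨μ, hμ, h, rfl⟩
  rintro r ⟨μ, hμ, h, rfl⟩
  exact M.spectralGapBound_le_one_sub h hμ

theorem spectralGapBound_le_spectralGap [Nontrivial V] : M.spectralGapBound ≤ M.spectralGap := by
  rw [spectralGap_eq]
  by_cases hne : ∃ x y, x ≠ y ∧ M.symm x y ≠ 0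
  · obtain ⟨μ, hμ, h⟩ := M.exists_eigenvalue_symm_ne_one hne
    refine le_csInf ⟨_, μ, hμ, h, rfl⟩ ?_
    rintro r ⟨μ, hμ, h, rfl⟩
    exact M.spectralGapBound_le_one_sub h hμ
  -- Without off-diagonal entries the lower bound is 0, and the infimum is nonnegative even with its
  -- default value 0 on the empty set.
  · push Not at hne
    have hflow : M.flowMin = 0 := by
      obtain ⟨x, x', hx⟩ := exists_pair_ne V
      refine le_antisymm ((M.flowMin_le (singleton_nonempty x) fun hc => ?_).trans_eq ?_)
        M.flowMin_nonneg
      · exact hx (mem_singleton.1 (hc ▸ mem_univ x')).symm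
      · refine sum_eq_zero fun a ha => sum_eq_zero fun y hy => ?_
        rw [mem_singleton] at ha
        subst ha
        have h1 := M.stat_mul_symm a y
        rw [hne a y (by simpa [eq_comm] using hy), mul_zero] at h1
        linarith [mul_nonneg (M.stat_nonneg a) (M.P_nonneg a y),
          mul_nonneg (M.stat_nonneg y) (M.P_nonneg y a)]
    rw [spectralGapBound, hflow, mul_zero, zero_div, zero_mul]
    refine Real.sInf_nonneg ?_
    rintro r ⟨μ, hμ, h, rfl⟩
    exact M.spectralGapBound_nonneg.trans (M.spectralGapBound_le_one_sub h hμ)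

end

end FiniteMarkovChain

/-! ### Leading order of the bounds. -/

open Real in
theorem abs_one_sub_cos_sub_le {θ e : ℝ} (hθ : |θ| ≤ 1) (he : θ ^ 2 ≤ e) :
    |1 - cos θ - θ ^ 2 / 2| ≤ e * (θ ^ 2 / 2) := by
  have h := cos_bound hθ
  rw [show |θ| ^ 4 = θ ^ 2 * θ ^ 2 by rw [← sq_abs]; ring] at h
  rw [← abs_neg, show -(1 - cos θ - θ ^ 2 / 2) = cos θ - (1 - θ ^ 2 / 2) by ring]
  refine h.trans ?_
  nlinarith [mul_le_mul_of_nonneg_left he (sq_nonneg θ), sq_nonneg θ]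

/-- The squeeze g ≤ -log(1-g) ≤ g/(1-g) makes the logarithm comparable to g, hence to G; inversion
enlarges the relative error to at most 4e. -/
theorem abs_inv_neg_log_sub_le {g G e : ℝ} (he : e ≤ 1 / 4) (hG : 0 < G)
    (hgG : |g - G| ≤ e * G) (hge : g ≤ e) :
    |1 / (-Real.log (1 - g)) - 1 / G| ≤ 4 * e * (1 / G) := by
  have he0 : 0 ≤ e := nonneg_of_mul_nonneg_left ((abs_nonneg _).trans hgG) hG
  obtain ⟨h1, h2⟩ := abs_le.1 hgG
  have hg : 0 < g := by nlinarith
  have hg1 : 0 < 1 - g := by linarith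
  have l1 : g ≤ -Real.log (1 - g) := by linarith [Real.log_le_sub_one_of_pos hg1]
  have l2 : -Real.log (1 - g) * (1 - g) ≤ g := by
    have := Real.one_sub_inv_le_log_of_pos hg1
    have h3 := mul_le_mul_of_nonneg_right this hg1.le
    rw [sub_mul, inv_mul_cancel₀ hg1.ne'] at h3
    linarith
  set l := -Real.log (1 - g)
  have hl : 0 < l := hg.trans_le l1
  have e1 : 1 / l - 1 / G = (G - l) / l * (1 / G) := by field_simp
  rw [e1, abs_mul, abs_of_pos (show 0 < 1 / G by positivity)]
  refine mul_le_mul_of_nonneg_right ?_ (by positivity)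
  rw [abs_div, abs_of_pos hl, div_le_iff₀ hl, abs_le]
  constructor <;> nlinarith

namespace FiniteMarkovChain

variable {V : Type u} [Fintype V] [DecidableEq V] (M : FiniteMarkovChain V)

theorem abs_gapBound_sub_le {e : ℝ} (he : e ≤ 1) (h : (2 * Real.pi * M.hatAMax) ^ 2 ≤ e) :
    |M.gapBound - 2 * Real.pi ^ 2 * M.hatPsiMin * M.hatAMax| ≤
      e * (2 * Real.pi ^ 2 * M.hatPsiMin * M.hatAMax) := by
  have hA := M.hatAMax_pos
  have hψ := M.hatPsiMin_nonneg
  have hb := abs_one_sub_cos_sub_le (θ := 2 * Real.pi * M.hatAMax)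
    (by rw [← sq_le_one_iff_abs_le_one]; linarith) h
  have e1 : 2 * Real.pi ^ 2 * M.hatPsiMin * M.hatAMax =
      M.hatPsiMin / M.hatAMax * ((2 * Real.pi * M.hatAMax) ^ 2 / 2) := by
    field_simp
  have hc : 0 ≤ M.hatPsiMin / M.hatAMax := div_nonneg hψ hA.le
  rw [e1, gapBound_eq, ← mul_sub, abs_mul, abs_of_nonneg hc]
  have := mul_le_mul_of_nonneg_left hb hc
  linarith

theorem abs_inv_neg_log_gapBound_sub_le {e : ℝ} (he : e ≤ 1 / 4) (hψ : 0 < M.hatPsiMin)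
    (h : (2 * Real.pi * M.hatAMax) ^ 2 ≤ e) (L : ℝ) :
    |1 / (-Real.log (1 - M.gapBound)) * L -
        1 / (2 * Real.pi ^ 2 * M.hatPsiMin * M.hatAMax) * L| ≤
      4 * e * |1 / (2 * Real.pi ^ 2 * M.hatPsiMin * M.hatAMax) * L| := by
  have hA := M.hatAMax_pos
  have hpi := Real.pi_pos
  have hG : 0 < 2 * Real.pi ^ 2 * M.hatPsiMin * M.hatAMax := by positivity
  have hg := M.abs_gapBound_sub_le (by linarith) h
  have hψA : M.hatPsiMin ≤ M.hatAMax := le_max_left _ _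
  have hge : M.gapBound ≤ e := by
    have h1 := (abs_le.1 hg).2
    have h2 : 2 * Real.pi ^ 2 * M.hatPsiMin * M.hatAMax ≤ (2 * Real.pi * M.hatAMax) ^ 2 / 2 := by
      calc _ ≤ 2 * Real.pi ^ 2 * M.hatAMax * M.hatAMax := by gcongr
        _ = _ := by ring
    nlinarith
  have := abs_inv_neg_log_sub_le he hG hg hge
  rw [← sub_mul, abs_mul, abs_mul (1 / _) L, abs_of_pos (one_div_pos.2 hG), ← mul_assoc]
  exact mul_le_mul_of_nonneg_right this (abs_nonneg _)

theorem abs_spectralGapBound_sub_le [Nonempty V] {e : ℝ} (he : e ≤ 1)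
    (h : (Real.pi * M.statMin) ^ 2 ≤ e) :
    |M.spectralGapBound - Real.pi ^ 2 * M.statMin * M.flowMin| ≤
      e * (Real.pi ^ 2 * M.statMin * M.flowMin) := by
  have hp := M.statMin_pos
  have hQ := M.flowMin_nonneg
  have hb := abs_one_sub_cos_sub_le (θ := Real.pi * M.statMin)
    (by rw [← sq_le_one_iff_abs_le_one]; linarith) h
  have e1 : Real.pi ^ 2 * M.statMin * M.flowMin =
      2 * M.flowMin / M.statMin * ((Real.pi * M.statMin) ^ 2 / 2) := by
    field_simp
  have hc : 0 ≤ 2 * M.flowMin / M.statMin := by positivity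
  rw [e1, spectralGapBound, ← mul_sub, abs_mul, abs_of_nonneg hc]
  have := mul_le_mul_of_nonneg_left hb hc
  linarith

end FiniteMarkovChain

theorem exists_sq_le_of_lt {δ : ℝ} (hδ : 0 < δ) (c : ℝ) (hc : 0 < c) :
    ∃ η : ℝ, 0 < η ∧ ∀ x, 0 < x → x < η → (c * x) ^ 2 ≤ δ := by
  refine ⟨Real.sqrt δ / c, div_pos (Real.sqrt_pos.2 hδ) hc, fun x hx hxη => ?_⟩
  rw [lt_div_iff₀ hc] at hxη
  calc (c * x) ^ 2 ≤ Real.sqrt δ ^ 2 := by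
        refine pow_le_pow_left₀ (by positivity) ?_ 2
        linarith
    _ = δ := Real.sq_sqrt hδ.le

/-! ### Sharpness for the drifted walk on an odd cycle. -/

namespace FiniteMarkovChain

section

variable {V : Type u} [Fintype V] [DecidableEq V] (M : FiniteMarkovChain V)

theorem le_hatPsi {A : Finset V} (hA : A.Nonempty) {r : ℝ}
    (h : ∀ (B : Finset V) (v : V), M.meas B ≤ M.meas Aᶜ → M.meas Aᶜ < M.meas (insert v B) →
      r ≤ ∑ x ∈ B, M.hatFlow A x + (M.meas Aᶜ - M.meas B) / M.stat v * M.hatFlow A v) :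
    r ≤ M.hatPsi A := by
  have hc : M.meas Aᶜ < ∑ y, M.stat y := by
    rw [M.stat_sum, M.meas_compl]; linarith [M.meas_pos hA]
  -- A constant height serves to produce some admissible pair, so that the infimum is not over the
  -- empty set.
  obtain ⟨B, v, -, h1, h2, -⟩ := exists_sublevel_greedy (h := fun _ => 0) (M.meas_nonneg Aᶜ) hc
  refine le_csInf ⟨_, B, v, h1, h2, rfl⟩ ?_
  rintro r ⟨B, v, h1, h2, rfl⟩
  exact h B v h1 h2

theorem le_hatPsiMin [Nontrivial V] {r : ℝ}
    (h : ∀ A : Finset V, A.Nonempty → M.meas A ≤ 1 / 2 → r ≤ M.hatPsi A) : r ≤ M.hatPsiMin := by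
  obtain ⟨A, hA, hA2⟩ := M.isStationaryPair.exists_sum_le_half
  refine le_csInf ⟨_, A, hA, hA2, rfl⟩ ?_
  rintro r ⟨A, hA, hA2, rfl⟩
  exact h A hA hA2

theorem ofReal_le_mixingTime {ε r : ℝ}
    (h : ∀ t : ℕ, (∀ x, tvDist ((M.P ^ t) x) M.stat ≤ ε) → r ≤ t) :
    ENNReal.ofReal r ≤ (M.mixingTime ε : ℝ≥0∞) := by
  have h1 : ((⌈r⌉₊ : ℕ) : ℕ∞) ≤ M.mixingTime ε :=
    le_iInf₂ fun t ht => by exact_mod_cast Nat.ceil_le.2 (h t ht)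
  calc ENNReal.ofReal r ≤ ((⌈r⌉₊ : ℕ) : ℝ≥0∞) := by
        rw [← ENNReal.ofReal_natCast]
        exact ENNReal.ofReal_le_ofReal (Nat.le_ceil r)
    _ = (((⌈r⌉₊ : ℕ) : ℕ∞) : ℝ≥0∞) := by simp
    _ ≤ _ := by exact_mod_cast h1

theorem isEigenvalue_of_eigenvector {z : ℂ} {v : V → ℂ} (hv0 : v ≠ 0)
    (hv : ∀ x, ∑ y, (M.P x y : ℂ) * v y = z * v x) : M.IsEigenvalue z := by
  refine Module.End.hasEigenvalue_of_hasEigenvector (x := v)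
    (Module.End.hasEigenvector_iff.2 ⟨Module.End.mem_eigenspace_iff.2 ?_, hv0⟩)
  ext x
  simpa [Matrix.toLin'_apply, Matrix.mulVec, dotProduct] using hv x

end

section cycle

open Finset

variable {n : ℕ} [NeZero n]

/-- A nonempty set invariant under translation by a unit is everything. -/
theorem eq_univ_of_add_unit_mem {A : Finset (ZMod n)} (hA : A.Nonempty) {s t : ZMod n}
    (hst : t * s = 1) (h : ∀ x ∈ A, x + s ∈ A) : A = univ := by
  obtain ⟨x, hx⟩ := hA
  have hk : ∀ k : ℕ, x + k * s ∈ A := by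
    intro k
    induction k with
    | zero => simpa using hx
    | succ k ih =>
      have := h _ ih
      rwa [show x + k * s + s = x + ((k + 1 : ℕ) : ZMod n) * s by push_cast; ring] at this
  refine eq_univ_iff_forall.2 fun z => ?_
  have := hk ((z - x) * t).val
  rwa [ZMod.natCast_zmod_val, mul_assoc, hst, mul_one, add_sub_cancel] at this

theorem sum_cycleMatrix_mul {R : Type*} [CommRing R] [Algebra ℝ R] (α : ℝ) (v : ZMod n → R)
    (x : ZMod n) : ∑ y, algebraMap ℝ R (cycleMatrix n α x y) * v y =
      algebraMap ℝ R α * v (x + 1) + algebraMap ℝ R (1 - α) * v (x - 1) := by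
  simp only [cycleMatrix, Matrix.of_apply, map_add, add_mul, sum_add_distrib]
  congr 1 <;> simp [apply_ite (algebraMap ℝ R), ite_mul]

variable (α : ℝ) (h0 : 0 < α) (h1 : α ≤ 1)

theorem cycleWalk_P : (cycleWalk n α h0 h1).P = cycleMatrix n α := rfl

theorem cycleWalk_stat (x : ZMod n) : (cycleWalk n α h0 h1).stat x = 1 / n := rfl

theorem cycleWalk_meas (A : Finset (ZMod n)) : (cycleWalk n α h0 h1).meas A = #A / n := by
  simp [meas, cycleWalk_stat, div_eq_mul_inv]

theorem cycleWalk_statMin : (cycleWalk n α h0 h1).statMin = 1 / n := by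
  simp [statMin, cycleWalk_stat]

theorem cycleWalk_deltaMin : (cycleWalk n α h0 h1).deltaMin = 1 / n := by
  have hn : (0 : ℝ) < n := Nat.cast_pos.2 (NeZero.pos n)
  apply le_antisymm
  · have := (cycleWalk n α h0 h1).deltaMin_le (A := {0}) (B := ∅)
      (by simp [cycleWalk_meas, hn.ne'])
    simpa [cycleWalk_meas] using this
  · obtain ⟨A, B, h, h'⟩ := (cycleWalk n α h0 h1).exists_deltaMin_eq
    rw [h']
    simp only [cycleWalk_meas] at h ⊢
    rw [← sub_div, abs_div, abs_of_pos hn]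
    refine div_le_div_of_nonneg_right ?_ hn.le
    have hne : (#A : ℤ) - #B ≠ 0 := by
      intro hc
      have : (#A : ℤ) = #B := by linarith
      apply h
      rw [show (#A : ℝ) = #B by exact_mod_cast this]
    have := Int.one_le_abs hne
    exact_mod_cast this

omit [NeZero n] in
theorem le_cycleMatrix_succ (h1 : α ≤ 1) (x : ZMod n) : α ≤ cycleMatrix n α x (x + 1) := by
  simp only [cycleMatrix, Matrix.of_apply, if_true]
  split_ifs <;> linarith

omit [NeZero n] in
theorem le_cycleMatrix_pred (h0 : 0 < α) (x : ZMod n) : 1 - α ≤ cycleMatrix n α x (x - 1) := by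
  simp only [cycleMatrix, Matrix.of_apply, if_true]
  split_ifs <;> linarith

theorem cycleWalk_flowMin (hn1 : 1 < n) : (cycleWalk n α h0 h1).flowMin = 1 / n := by
  have hn : (0 : ℝ) < n := Nat.cast_pos.2 (NeZero.pos n)
  have : Fact (1 < n) := ⟨hn1⟩
  set W := cycleWalk n α h0 h1 with hW
  apply le_antisymm
  · refine (W.flowMin_le (singleton_nonempty 0) fun hc => ?_).trans ?_
    · have := hc ▸ mem_univ (1 : ZMod n)
      simp at this
    · rw [flow, sum_singleton, ← mul_sum]
      have h2 : ∑ y ∈ ({0} : Finset (ZMod n))ᶜ, W.P 0 y ≤ 1 := by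
        rw [← W.P_row_sum 0]
        exact sum_le_sum_of_subset_of_nonneg (subset_univ _) fun y _ _ => W.P_nonneg 0 y
      exact mul_le_of_le_one_right (W.stat_nonneg 0) h2
  · refine le_csInf ⟨_, {0}, singleton_nonempty 0, fun hc => ?_, rfl⟩ ?_
    · have := hc ▸ mem_univ (1 : ZMod n)
      simp at this
    rintro r ⟨A, hA, hA', rfl⟩
    obtain ⟨x, hx, hx'⟩ : ∃ x ∈ A, x + 1 ∉ A := by
      by_contra! hc
      exact hA' (eq_univ_of_add_unit_mem hA (one_mul 1) hc)
    obtain ⟨y, hy, hy'⟩ : ∃ y ∈ A, y - 1 ∉ A := by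
      by_contra! hc
      exact hA' (eq_univ_of_add_unit_mem hA (s := -1) (t := -1) (by ring)
        fun x hx => by simpa [sub_eq_add_neg] using hc x hx)
    -- Clockwise and counterclockwise flow are bounded separately, which stays valid when x + 1 = x
    -- - 1.
    have e : W.flow A Aᶜ = (∑ x ∈ A, ∑ y ∈ Aᶜ, 1 / n * (if y = x + 1 then α else 0)) +
        ∑ x ∈ A, ∑ y ∈ Aᶜ, 1 / n * (if y = x - 1 then 1 - α else 0) := by
      simp only [flow, ← sum_add_distrib, ← mul_add]
      rfl
    have hα : 0 ≤ 1 - α := by linarith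
    have n1 : ∀ x y : ZMod n, (0 : ℝ) ≤ 1 / n * (if y = x + 1 then α else 0) := fun x y => by
      split_ifs <;> positivity
    have n2 : ∀ x y : ZMod n, (0 : ℝ) ≤ 1 / n * (if y = x - 1 then 1 - α else 0) := fun x y => by
      split_ifs <;> positivity
    have t1 : 1 / n * α ≤ ∑ x ∈ A, ∑ y ∈ Aᶜ, 1 / n * (if y = x + 1 then α else 0) := by
      refine le_trans ?_ (single_le_sum (fun x _ => sum_nonneg fun y _ => n1 x y) hx)
      refine le_trans ?_ (single_le_sum (fun y _ => n1 x y) (mem_compl.2 hx'))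
      simp
    have t2 : 1 / n * (1 - α) ≤
        ∑ x ∈ A, ∑ y ∈ Aᶜ, 1 / n * (if y = x - 1 then 1 - α else 0) := by
      refine le_trans ?_ (single_le_sum (fun x _ => sum_nonneg fun y _ => n2 x y) hy)
      refine le_trans ?_ (single_le_sum (fun x _ => n2 y x) (mem_compl.2 hy'))
      simp
    rw [e]
    linarith

theorem cycleWalk_le_hatFlow (hα : 1 / 2 ≤ α) {A : Finset (ZMod n)} {x : ZMod n}
    (hx : x - 1 ∈ A ∨ x + 1 ∈ A) : (1 - α) / n ≤ (cycleWalk n α h0 h1).hatFlow A x := by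
  have hn : (0 : ℝ) < n := Nat.cast_pos.2 (NeZero.pos n)
  set W := cycleWalk n α h0 h1 with hW
  have hflow : ∀ y ∈ A, W.P y x / n ≤ W.flow A {x} := by
    intro y hy
    rw [flow]
    refine le_trans ?_ (single_le_sum (fun x _ => sum_nonneg fun y _ =>
      mul_nonneg (W.stat_nonneg x) (W.P_nonneg x y)) hy)
    rw [sum_singleton, hW, cycleWalk_stat, one_div, inv_mul_eq_div]
  refine le_min ?_ ?_
  · rcases hx with hx | hx
    · refine le_trans ?_ (hflow _ hx)
      have := le_cycleMatrix_succ α h1 (x - 1)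
      rw [sub_add_cancel] at this
      refine div_le_div_of_nonneg_right ?_ hn.le
      rw [hW, cycleWalk_P]; linarith
    · refine le_trans ?_ (hflow _ hx)
      have := le_cycleMatrix_pred α h0 (x + 1)
      rw [add_sub_cancel_right] at this
      exact div_le_div_of_nonneg_right this hn.le
  · rw [hW, cycleWalk_stat, div_div, div_le_div_iff₀ hn (by positivity)]
    nlinarith

omit [NeZero n] in
theorem two_mul_unit (hodd : Odd n) : ∃ t : ZMod n, t * 2 = 1 := by
  obtain ⟨k, hk⟩ := hodd
  refine ⟨-k, ?_⟩
  have : ((2 * k + 1 : ℕ) : ZMod n) = 0 := by rw [← hk]; simp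
  push_cast at this
  linear_combination -this

/-- The upper bound takes A = {0} and lets B omit the successor of 0, which receives the flow α/n.
For the lower bound some vertex of B is adjacent to A, and one neighbour already carries truncated
flow (1-α)/n. -/
theorem cycleWalk_hatPsiMin (hn1 : 1 < n) (hodd : Odd n) (hα : 1 / 2 ≤ α) :
    (cycleWalk n α h0 h1).hatPsiMin = (1 - α) / n := by
  have hn : (0 : ℝ) < n := Nat.cast_pos.2 (NeZero.pos n)
  have : Fact (1 < n) := ⟨hn1⟩
  set W := cycleWalk n α h0 h1 with hW
  have hcompl : ∀ A : Finset (ZMod n), #Aᶜ = n - #A := fun A => by rw [card_compl, ZMod.card]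
  have hle : ∀ A : Finset (ZMod n), #A ≤ n := fun A => by simpa [ZMod.card] using card_le_univ A
  apply le_antisymm
  · have h01 : W.meas {0} ≤ 1 / 2 := by
      rw [hW, cycleWalk_meas, card_singleton, Nat.cast_one, div_le_div_iff₀ hn two_pos, one_mul,
        one_mul]
      exact_mod_cast hn1
    refine (W.hatPsiMin_le (singleton_nonempty 0) h01).trans ?_
    have hB : W.meas {1}ᶜ = W.meas {0}ᶜ := by
      simp only [hW, cycleWalk_meas, hcompl, card_singleton]
    refine (W.hatPsi_le (B := {1}ᶜ) (v := 1) hB.le ?_).trans ?_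
    · rw [insert_compl_self, hW, cycleWalk_meas, cycleWalk_meas]
      refine div_lt_div_of_pos_right ?_ hn
      norm_cast
      refine card_lt_card ⟨subset_univ _, fun hc => ?_⟩
      simpa using hc (mem_univ 0)
    · rw [hB, sub_self, zero_div, zero_mul, add_zero]
      have h2 : W.P 0 1 + ∑ x ∈ ({1} : Finset (ZMod n))ᶜ, W.P 0 x = 1 := by
        rw [← W.P_row_sum 0, ← sum_add_sum_compl {1}, sum_singleton]
      have h3 : α ≤ W.P 0 1 := by
        have := le_cycleMatrix_succ α h1 (0 : ZMod n)
        rwa [zero_add] at this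
      calc ∑ x ∈ ({1} : Finset (ZMod n))ᶜ, W.hatFlow {0} x
          ≤ ∑ x ∈ ({1} : Finset (ZMod n))ᶜ, W.P 0 x / n := by
            refine sum_le_sum fun x _ => (min_le_left _ _).trans_eq ?_
            rw [flow, sum_singleton, sum_singleton, hW, cycleWalk_stat, one_div, inv_mul_eq_div]
        _ ≤ (1 - α) / n := by
            rw [← sum_div]
            exact div_le_div_of_nonneg_right (by linarith) hn.le
  · refine W.le_hatPsiMin fun A hA hA2 => W.le_hatPsi hA fun B v hB hv => ?_
    rw [hW, cycleWalk_meas, cycleWalk_meas] at hB hv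
    rw [div_le_div_iff_of_pos_right hn, Nat.cast_le] at hB
    rw [div_lt_div_iff_of_pos_right hn, Nat.cast_lt] at hv
    -- Measures are multiples of 1/n, so B attains the measure of Aᶜ exactly and no fractional term
    -- remains.
    have hcard : #B = #Aᶜ := by
      have := card_insert_le v B
      omega
    have hmeas : W.meas B = W.meas Aᶜ := by rw [hW, cycleWalk_meas, cycleWalk_meas, hcard]
    rw [hmeas, sub_self, zero_div, zero_mul, add_zero]
    -- Otherwise A + 1 and A - 1 both fill Bᶜ, which has the size of A. Then A is invariant under
    -- translation by 2, a unit for odd n, and A would be everything.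
    obtain ⟨x, hxB, hx⟩ : ∃ x ∈ B, x - 1 ∈ A ∨ x + 1 ∈ A := by
      by_contra! hc
      have hBc : #Bᶜ = #A := by
        have := hle A
        rw [hcompl, hcard, hcompl]; omega
      have i1 : A.image (· + 1) = Bᶜ := by
        refine eq_of_subset_of_card_le (fun y hy => ?_) ?_
        · obtain ⟨a, ha, rfl⟩ := mem_image.1 hy
          exact mem_compl.2 fun hb => (hc _ hb).1 (by simpa using ha)
        · rw [hBc, card_image_of_injective _ (add_left_injective 1)]
      have i2 : A.image (· - 1) = Bᶜ := by
        refine eq_of_subset_of_card_le (fun y hy => ?_) ?_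
        · obtain ⟨a, ha, rfl⟩ := mem_image.1 hy
          exact mem_compl.2 fun hb => (hc _ hb).2 (by simpa using ha)
        · rw [hBc, card_image_of_injective _ (sub_left_injective)]
      obtain ⟨t, ht⟩ := two_mul_unit hodd
      have hu : A = univ := by
        refine eq_univ_of_add_unit_mem hA ht fun a ha => ?_
        have h2 : a + 1 ∈ A.image (· - 1) := by
          rw [i2, ← i1]; exact mem_image_of_mem _ ha
        obtain ⟨b, hb, hab⟩ := mem_image.1 h2
        rwa [show a + 2 = b by linear_combination -hab]
      rw [hu, meas, W.stat_sum] at hA2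
      norm_num at hA2
    exact (cycleWalk_le_hatFlow α h0 h1 hα hx).trans
      (single_le_sum (fun x _ => W.hatFlow_nonneg A x) hxB)

theorem cycleWalk_gapBound (hn1 : 1 < n) (hodd : Odd n) (hα : 1 / 2 ≤ α) :
    (cycleWalk n α h0 h1).gapBound = 2 * (1 - α) * (1 - Real.cos (Real.pi / n)) := by
  have hn : (0 : ℝ) < n := Nat.cast_pos.2 (NeZero.pos n)
  have h : (1 - α) / n ≤ 1 / n / 2 := by
    rw [div_div, div_le_div_iff₀ hn (by positivity)]; nlinarith
  rw [gapBound, hatAMin, hatAMax, cycleWalk_hatPsiMin α h0 h1 hn1 hodd hα, cycleWalk_deltaMin,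
    min_eq_left h, max_eq_right h]
  congr 3
  · field_simp
  · field_simp

theorem cycleWalk_spectralGapBound (hn1 : 1 < n) :
    (cycleWalk n α h0 h1).spectralGapBound = 2 * (1 - Real.cos (Real.pi / n)) := by
  have hn : (0 : ℝ) < n := Nat.cast_pos.2 (NeZero.pos n)
  rw [spectralGapBound, cycleWalk_flowMin α h0 h1 hn1, cycleWalk_statMin, mul_one_div]
  field_simp

omit [NeZero n] in
theorem half_le_cos_pi_div (hn : 3 ≤ n) : 1 / 2 ≤ Real.cos (Real.pi / n) := by
  rw [← Real.cos_pi_div_three]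
  have : (3 : ℝ) ≤ n := by exact_mod_cast hn
  have hpi := Real.pi_pos
  refine Real.cos_le_cos_of_nonneg_of_le_pi (by positivity) (by linarith) ?_
  gcongr

omit [NeZero n] in
theorem cos_pi_div_lt_one (hn : 3 ≤ n) : Real.cos (Real.pi / n) < 1 := by
  have : (3 : ℝ) ≤ n := by exact_mod_cast hn
  have hpi := Real.pi_pos
  rw [← Real.cos_zero]
  refine Real.cos_lt_cos_of_nonneg_of_le_pi le_rfl ?_ (by positivity)
  exact div_le_self hpi.le (by linarith)

theorem cycleWalk_spectralGap_le (hn : 3 ≤ n) :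
    (cycleWalk n α h0 h1).spectralGap ≤ 2 * (cycleWalk n α h0 h1).spectralGapBound := by
  have hn1 : 1 < n := by omega
  have : Fact (1 < n) := ⟨hn1⟩
  have hn0 : (0 : ℝ) < n := Nat.cast_pos.2 (NeZero.pos n)
  set W := cycleWalk n α h0 h1 with hW
  set c := Real.cos (Real.pi / n) with hc
  have hc1 : c < 1 := cos_pi_div_lt_one hn
  have hc2 : 1 / 2 ≤ c := half_le_cos_pi_div hn
  have hχ1 : (ZMod.stdAddChar (1 : ZMod n)).re = 2 * c ^ 2 - 1 ∧
      (ZMod.stdAddChar (-1 : ZMod n)).re = 2 * c ^ 2 - 1 ∧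
      (ZMod.stdAddChar (-1 : ZMod n)).im = - (ZMod.stdAddChar (1 : ZMod n)).im := by
    have e1 := ZMod.stdAddChar_coe (N := n) 1
    have e2 := ZMod.stdAddChar_coe (N := n) (-1)
    push_cast at e1 e2
    rw [show 2 * (Real.pi : ℂ) * Complex.I * 1 / n =
      ((2 * (Real.pi / n) : ℝ) : ℂ) * Complex.I by push_cast; ring] at e1
    rw [show 2 * (Real.pi : ℂ) * Complex.I * -1 / n =
      ((-(2 * (Real.pi / n)) : ℝ) : ℂ) * Complex.I by push_cast; ring] at e2
    rw [e1, e2, Complex.exp_ofReal_mul_I_re, Complex.exp_ofReal_mul_I_re,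
      Complex.exp_ofReal_mul_I_im, Complex.exp_ofReal_mul_I_im, Real.cos_neg, Real.sin_neg,
      Real.cos_two_mul]
    exact ⟨rfl, rfl, rfl⟩
  -- The symmetrization is the simple random walk whatever α is, and the character of frequency 1
  -- has eigenvalue cos(2π/n). The gap 2(1-c)(1+c) is then at most twice the bound 2(1-c).
  have heig : Module.End.HasEigenvalue (Matrix.toLin' W.symm) (2 * c ^ 2 - 1) := by
    refine Module.End.hasEigenvalue_of_hasEigenvector
      (x := fun x : ZMod n => (ZMod.stdAddChar x).re)
      (Module.End.hasEigenvector_iff.2 ⟨Module.End.mem_eigenspace_iff.2 ?_, fun h => ?_⟩)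
    · ext x
      simp only [Matrix.toLin'_apply, Matrix.mulVec, dotProduct, Pi.smul_apply, smul_eq_mul]
      have hs : ∀ y, W.symm x y = ((if y = x + 1 then 1 else 0) + if y = x - 1 then 1 else 0) / 2 := by
        intro y
        have h := W.stat_mul_symm x y
        simp only [hW, cycleWalk_stat, cycleWalk_P, cycleMatrix, Matrix.of_apply] at h
        have e1 : x = y + 1 ↔ y = x - 1 := by
          constructor <;> rintro rfl <;> ring
        have e2 : x = y - 1 ↔ y = x + 1 := by
          constructor <;> rintro rfl <;> ring
        simp only [e1, e2] at h
        field_simp at h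
        rw [hW, eq_div_iff two_ne_zero, h]
        split_ifs <;> ring
      simp only [hs, add_div, add_mul, sum_add_distrib]
      simp only [ite_div, zero_div, ite_mul, zero_mul, sum_ite_eq', mem_univ, if_true]
      rw [sub_eq_add_neg, AddChar.map_add_eq_mul, AddChar.map_add_eq_mul, Complex.mul_re,
        Complex.mul_re, hχ1.1, hχ1.2.1, hχ1.2.2]
      ring
    · have := congrFun h 0
      simp at this
  refine (W.spectralGap_le (by nlinarith) heig).trans ?_
  rw [hW, cycleWalk_spectralGapBound α h0 h1 hn1, ← hc]
  nlinarith

/-- An eigenvalue of the walk on an odd cycle that is almost `-1` for `α = 1 / 2`. -/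
theorem cycleWalk_exists_eigenvalue (hodd : Odd n) :
    ∃ (z : ℂ) (v : ZMod n → ℂ), v ≠ 0 ∧
      (∀ x, ∑ y, ((cycleWalk n α h0 h1).P x y : ℂ) * v y = z * v x) ∧
      ‖z‖ ^ 2 = 1 - 4 * α * (1 - α) * (1 - Real.cos (Real.pi / n) ^ 2) := by
  have hn0 : (n : ℝ) ≠ 0 := NeZero.ne _
  obtain ⟨k, hk⟩ := hodd
  -- The frequency k = (n-1)/2 has angle π - π/n, as close to π as an odd cycle allows.
  set w : ℂ := ZMod.stdAddChar (k : ZMod n) with hw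
  have hval : w = Complex.exp (((Real.pi - Real.pi / n : ℝ) : ℂ) * Complex.I) := by
    have e1 := ZMod.stdAddChar_coe (N := n) k
    push_cast at e1
    rw [hw, e1]
    congr 1
    have hn' : (n : ℂ) ≠ 0 := NeZero.ne _
    have hk' : (n : ℂ) = 2 * k + 1 := by exact_mod_cast hk
    push_cast
    field_simp
    rw [hk']; ring
  have hinv : ZMod.stdAddChar (-(k : ZMod n)) =
      Complex.exp (((-(Real.pi - Real.pi / n) : ℝ) : ℂ) * Complex.I) := by
    rw [AddChar.map_neg_eq_inv, ← hw, hval, ← Complex.exp_neg]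
    congr 1
    push_cast; ring
  refine ⟨α * w + (1 - α : ℝ) * ZMod.stdAddChar (-(k : ZMod n)),
    fun x => ZMod.stdAddChar ((k : ZMod n) * x), fun h => ?_, fun x => ?_, ?_⟩
  · have := congrFun h 0
    simp at this
  · have := sum_cycleMatrix_mul α (fun x : ZMod n => ZMod.stdAddChar ((k : ZMod n) * x)) x
    simp only [Complex.coe_algebraMap] at this
    rw [show (k : ZMod n) * (x + 1) = k * x + k by ring,
      show (k : ZMod n) * (x - 1) = k * x + -k by ring, AddChar.map_add_eq_mul,
      AddChar.map_add_eq_mul] at this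
    rw [cycleWalk_P, this, hw]
    ring
  · rw [hinv, hval, ← Complex.normSq_eq_norm_sq, Complex.normSq_apply]
    simp only [Complex.add_re, Complex.add_im, Complex.re_ofReal_mul, Complex.im_ofReal_mul,
      Complex.exp_ofReal_mul_I_re, Complex.exp_ofReal_mul_I_im, Real.cos_neg, Real.sin_neg,
      Real.cos_pi_sub, Real.sin_pi_sub]
    have := Real.sin_sq_add_cos_sq (Real.pi / n)
    linear_combination (2 * α - 1) ^ 2 * this

/-- Used with b = 1 - α, d = 1 - cos(π/n) and r the modulus of the eigenvalue, so that g = 2bd; the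
last two conclusions are 1 - 2g ≤ r and (1-g)^2 ≤ r. -/
theorem le_of_sq_eq {b d r : ℝ} (b0 : 0 < b) (b1 : b ≤ 1 / 2) (d0 : 0 < d) (d1 : d ≤ 1 / 2)
    (hr0 : 0 ≤ r) (hr : r ^ 2 = 1 - 4 * (b * d) * (1 - b) * (2 - d)) :
    r < 1 ∧ 1 - 4 * (b * d) ≤ r ∧ (1 - 2 * (b * d)) ^ 2 ≤ r := by
  have hbd : 0 < b * d := mul_pos b0 d0
  have hbd1 : b * d ≤ 1 / 4 := by nlinarith
  refine ⟨?_, ?_, ?_⟩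
  · have : 0 < 4 * (b * d) * (1 - b) * (2 - d) := by
      have h2 : 0 < 1 - b := by linarith
      have h3 : 0 < 2 - d := by linarith
      positivity
    nlinarith
  · refine le_of_abs_le (abs_le_of_sq_le_sq ?_ hr0)
    rw [hr]
    have : 0 ≤ (b * d) * (d + 2 * b - 5 * (b * d)) := mul_nonneg hbd.le (by nlinarith)
    nlinarith
  · refine le_of_abs_le (abs_le_of_sq_le_sq ?_ hr0)
    rw [hr]
    -- A quadratic in b: for d ≤ 2/7 its coefficients are nonnegative, and beyond that its
    -- discriminant is nonpositive, which `h1` and the completed square in `h2` express.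
    have key : 0 ≤ d + 2 * b - 7 * (b * d) + 7 * (b * d) ^ 2 := by
      rcases le_or_gt d (2 / 7) with h | h
      · nlinarith [mul_nonneg b0.le (show 0 ≤ 2 - 7 * d by linarith), sq_nonneg (b * d)]
      · have h1 : 0 ≤ 28 * d ^ 3 - (2 - 7 * d) ^ 2 := by
          nlinarith [mul_nonneg (mul_nonneg (sub_nonneg.2 h.le) (sub_nonneg.2 d1)) d0.le,
            mul_nonneg (sub_nonneg.2 h.le) (sub_nonneg.2 d1)]
        have h2 : 0 ≤ 28 * d ^ 2 * (d + 2 * b - 7 * (b * d) + 7 * (b * d) ^ 2) := by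
          nlinarith [sq_nonneg (14 * d ^ 2 * b + (2 - 7 * d))]
        exact nonneg_of_mul_nonneg_right h2 (by positivity)
    have h3 : (1 - b * d) ^ 2 ≤ 1 - 7 / 4 * (b * d) := by nlinarith
    have h4 := mul_le_mul_of_nonneg_left h3 hbd.le
    have key2 : 0 ≤ d + 2 * b - 3 * (b * d) - 4 * (b * d) * (1 - b * d) ^ 2 := by linarith
    have := mul_nonneg hbd.le key2
    linarith

theorem cycleWalk_sharp (hn : 3 ≤ n) (hodd : Odd n) (hα : 1 / 2 ≤ α) (hα1 : α < 1) :
    ∃ (z : ℂ) (v : ZMod n → ℂ), v ≠ 0 ∧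
      (∀ x, ∑ y, ((cycleWalk n α h0 h1).P x y : ℂ) * v y = z * v x) ∧ ‖z‖ < 1 ∧
      1 - 2 * (cycleWalk n α h0 h1).gapBound ≤ ‖z‖ ∧
      (1 - (cycleWalk n α h0 h1).gapBound) ^ 2 ≤ ‖z‖ := by
  obtain ⟨z, v, hv0, hv, hz⟩ := cycleWalk_exists_eigenvalue α h0 h1 hodd
  rw [cycleWalk_gapBound α h0 h1 (by omega) hodd hα]
  set c := Real.cos (Real.pi / n) with hc
  have hc1 : c < 1 := cos_pi_div_lt_one hn
  have hc2 : 1 / 2 ≤ c := half_le_cos_pi_div hn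
  have hnz := norm_nonneg z
  obtain ⟨t1, t2, t3⟩ := le_of_sq_eq (b := 1 - α) (d := 1 - c) (by linarith) (by linarith)
    (by linarith) (by linarith) hnz (by rw [hz]; ring)
  exact ⟨z, v, hv0, hv, t1, by linarith, by linarith⟩

theorem cycleWalk_le_mixingTime (hn : 3 ≤ n) (hodd : Odd n) (hα : 1 / 2 ≤ α) (hα1 : α < 1)
    {ε : ℝ} : ENNReal.ofReal
      (1 / 2 * (1 / (-Real.log (1 - (cycleWalk n α h0 h1).gapBound)) * Real.log (1 / (2 * ε)))) ≤
        ((cycleWalk n α h0 h1).mixingTime ε : ℝ≥0∞) := by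
  have : Fact (1 < n) := ⟨by omega⟩
  obtain ⟨z, v, hv0, hv, hz1, -, hz⟩ := cycleWalk_sharp α h0 h1 hn hodd hα hα1
  have hc1 : Real.cos (Real.pi / n) < 1 := cos_pi_div_lt_one hn
  have hc2 : 1 / 2 ≤ Real.cos (Real.pi / n) := half_le_cos_pi_div hn
  have hgap := cycleWalk_gapBound α h0 h1 (by omega) hodd hα
  have hg0 : 0 < (cycleWalk n α h0 h1).gapBound := by
    rw [hgap]; exact mul_pos (by linarith) (by linarith)
  have hg1 : (cycleWalk n α h0 h1).gapBound < 1 := by rw [hgap]; nlinarith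
  set W := cycleWalk n α h0 h1 with hW
  refine W.ofReal_le_mixingTime fun t ht => ?_
  obtain ⟨x, hx⟩ := IsStationaryPair.exists_norm_pow_le hv hv0
    (W.isStationaryPair.sum_mul_eigenvector_eq_zero hv fun h => by rw [h] at hz1; simp at hz1)
  have h2 : ∑ y, |(W.P ^ t) x y - W.stat y| ≤ 2 * ε := by
    have := ht x
    rw [tvDist] at this
    linarith
  have hr : 0 < 1 - W.gapBound := by linarith
  -- The square is what costs the factor 1/2 in the lower bound, after taking logarithms.
  have h3 : ((1 - W.gapBound) ^ 2) ^ t ≤ 2 * ε :=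
    (pow_le_pow_left₀ (by positivity) hz t).trans ((hx t).trans h2)
  have h4 := Real.log_le_log (by positivity) h3
  rw [Real.log_pow, Real.log_pow] at h4
  push_cast at h4
  have hl : 0 < -Real.log (1 - W.gapBound) := by linarith [Real.log_neg hr (by linarith)]
  rw [one_div (2 * ε), Real.log_inv, one_div (-Real.log _), ← mul_assoc, mul_comm (1 / 2 : ℝ),
    mul_assoc, inv_mul_le_iff₀ hl]
  linarith

end cycle

end FiniteMarkovChain

theorem theorem4 :
    -- the bounds, for every finite irreducible Markov chain with at least two states
    (∀ (V : Type u) [Fintype V] [DecidableEq V] [Nontrivial V] (M : FiniteMarkovChain V),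
      (0 < M.hatPsiMin → ∀ ε : ℝ, 0 < ε →
        (M.gapBound < 1 → M.mixingTime ε ≤
          (⌈1 / (-Real.log (1 - M.gapBound)) * Real.log ((1 - M.statMin) / ε)⌉₊ : ℕ∞)) ∧
        (1 ≤ M.gapBound → M.mixingTime ε ≤ 1)) ∧
      (∀ z : ℂ, M.IsEigenvalue z → z ≠ 1 → M.gapBound ≤ 1 - ‖z‖) ∧
      M.spectralGapBound ≤ M.spectralGap) ∧
    -- the leading order of the bounds when `hatAMax`, respectively `statMin`, tends to zero
    (∀ δ : ℝ, 0 < δ → ∃ η : ℝ, 0 < η ∧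
      ∀ (V : Type u) [Fintype V] [DecidableEq V] [Nontrivial V] (M : FiniteMarkovChain V),
      (M.hatAMax < η → 0 < M.hatPsiMin → ∀ ε : ℝ, 0 < ε →
        |1 / (-Real.log (1 - M.gapBound)) * Real.log ((1 - M.statMin) / ε) -
            1 / (2 * Real.pi ^ 2 * M.hatPsiMin * M.hatAMax) * Real.log ((1 - M.statMin) / ε)| ≤
          δ * |1 / (2 * Real.pi ^ 2 * M.hatPsiMin * M.hatAMax) *
            Real.log ((1 - M.statMin) / ε)|) ∧
      (M.hatAMax < η →
        |M.gapBound - 2 * Real.pi ^ 2 * M.hatPsiMin * M.hatAMax| ≤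
          δ * (2 * Real.pi ^ 2 * M.hatPsiMin * M.hatAMax)) ∧
      (M.statMin < η →
        |M.spectralGapBound - Real.pi ^ 2 * M.statMin * M.flowMin| ≤
          δ * (Real.pi ^ 2 * M.statMin * M.flowMin))) ∧
    -- sharpness up to a factor two: the walk with clockwise drift on a cycle of odd length
    (∀ (n : ℕ) [NeZero n] (α : ℝ) (h0 : 0 < α) (h1 : α ≤ 1), 3 ≤ n → Odd n → 1 / 2 ≤ α → α < 1 →
      ∀ M : FiniteMarkovChain (ZMod n), M = FiniteMarkovChain.cycleWalk n α h0 h1 →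
      M.hatPsiMin = (1 - α) * M.statMin ∧
      (∀ ε : ℝ, 0 < ε → ENNReal.ofReal
          (1 / 2 * (1 / (-Real.log (1 - M.gapBound)) * Real.log (1 / (2 * ε)))) ≤
        (M.mixingTime ε : ℝ≥0∞)) ∧
      (∃ z : ℂ, M.IsEigenvalue z ∧ z ≠ 1 ∧ 1 - ‖z‖ ≤ 2 * M.gapBound) ∧
      M.spectralGap ≤ 2 * M.spectralGapBound) := by 
  refine ⟨fun V _ _ _ M => ⟨fun hψ ε hε => ⟨M.mixingTime_le_ceil hψ hε, M.mixingTime_le_one hε⟩,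
    fun z => M.gapBound_le_one_sub_norm, M.spectralGapBound_le_spectralGap⟩, fun δ hδ => ?_,
    fun n _ α h0 h1 hn hodd hα hα1 M hM => ?_⟩
  -- The quarter of δ absorbs the factor 4 of `abs_inv_neg_log_gapBound_sub_le`.
  · have he : 0 < min (δ / 4) (1 / 4) := by positivity
    have he1 : min (δ / 4) (1 / 4) ≤ 1 / 4 := min_le_right _ _
    have he2 : min (δ / 4) (1 / 4) ≤ δ / 4 := min_le_left _ _
    have hpi := Real.pi_pos
    obtain ⟨η₁, hη₁, h1⟩ := exists_sq_le_of_lt he (2 * Real.pi) (by positivity)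
    obtain ⟨η₂, hη₂, h2⟩ := exists_sq_le_of_lt he Real.pi hpi
    refine ⟨min η₁ η₂, lt_min hη₁ hη₂, fun V _ _ _ M => ⟨fun hA hψ ε _ => ?_, fun hA => ?_,
      fun hs => ?_⟩⟩
    · refine (M.abs_inv_neg_log_gapBound_sub_le he1 hψ
        (h1 _ M.hatAMax_pos (lt_min_iff.1 hA).1) _).trans ?_
      exact mul_le_mul_of_nonneg_right (by linarith) (abs_nonneg _)
    · refine (M.abs_gapBound_sub_le (by linarith)
        (h1 _ M.hatAMax_pos (lt_min_iff.1 hA).1)).trans ?_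
      have := M.hatPsiMin_nonneg
      have := M.hatAMax_pos
      exact mul_le_mul_of_nonneg_right (by linarith) (by positivity)
    · refine (M.abs_spectralGapBound_sub_le (by linarith)
        (h2 _ M.statMin_pos (lt_min_iff.1 hs).2)).trans ?_
      have := M.statMin_pos
      have := M.flowMin_nonneg
      exact mul_le_mul_of_nonneg_right (by linarith) (by positivity)
  · subst hM
    refine ⟨?_, fun ε _ => FiniteMarkovChain.cycleWalk_le_mixingTime α h0 h1 hn hodd hα hα1, ?_,
      FiniteMarkovChain.cycleWalk_spectralGap_le α h0 h1 hn⟩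
    · rw [FiniteMarkovChain.cycleWalk_hatPsiMin α h0 h1 (by omega) hodd hα,
        FiniteMarkovChain.cycleWalk_statMin, mul_one_div]
    · obtain ⟨z, v, hv0, hv, hz1, hz, -⟩ :=
        FiniteMarkovChain.cycleWalk_sharp α h0 h1 hn hodd hα hα1
      refine ⟨z, FiniteMarkovChain.isEigenvalue_of_eigenvector _ hv0 hv, fun h => ?_,
        by linarith⟩
      rw [h] at hz1
      simp at hz1
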